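/- **Theorem 2.2 (Convergence for quasi-equidistributing meshes).** Let $\Omega=(0,1)$, $V=H^1_0(\Omega)$, and let $a,b\in W^{1,\infty}(\Omega)$, $c\in L^\infty(\Omega)$ satisfy $a\ge a_0>0$ and $c-\tfrac12 b'\ge 0$ a.e. in $\Omega$ for some constant $a_0$. For $f\in L^2(\Omega)$ let $u\in V$ be the weak solution of $-(au')'+bu'+cu=f$, $u(0)=u(1)=0$, i.e. $$B(u,v)=\int_\Omega (au'v'+bu'v+cuv)\,dx=\int_\Omega fv\,dx\qquad\text{for all } v\in V,$$ and put $r=f+a'u'-bu'-cu$. For a mesh $0=x_0<x_1<\dots<x_N=1$ let $h_i=x_i-x_{i-1}$, let $V_h\subset V$ be the span of the linear basis (hat) functions of the interior mesh points, and let $u_h\in V_h$ be the linear finite element solution, $B(u_h,v_h)=\int_\Omega fv_h\,dx$ for all $v_h\in V_h$. Put $r_h=f+a'u_h'-bu_h'-cu_h$ and $$\langle r_h\rangle_i=\Big(\frac1{h_i}\int_{x_{i-1}}^{x_i}|r_h|^2dx\Big)^{1/2},\quad \alpha_h=\Big[\sum_{i=1}^N h_i\langle r_h\rangle_i^{2/3}\Big]^3,\quad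 \rho_i=\Big(1+\frac{1}{\alpha_h}\langle r_h\rangle_i^2\Big)^{1/3},\quad \sigma_h=\sum_{i=1}^N\rho_ih_i ,$$ with $\rho_i=1$ for all $i$ in the degenerate case $\alpha_h=0$. For $\kappa>0$, call the mesh quasi-equidistributing with constant $\kappa$ if $N\rho_ih_i/\sigma_h\le\kappa$ for $i=1,\dots,N$. Write $\|v\|_{L^{2/3}(\Omega)}=(\int_\Omega|v|^{2/3}dx)^{3/2}$. There are positive constants $C$ and $c_1$, depending only on $a,b,c$ (and $a_0$), but not on $f$, $u$, $\kappa$, $N$ or the mesh, such that for every $f\in L^2(\Omega)$ and every $\kappa>0$ the following hold. 1. For every mesh that is quasi-equidistributing with constant $\kappa$, $$\|(u-u_h)'\|_{L^2(\Omega)}\le\frac{C\sqrt{\alpha_h\kappa^3}}{N}.$$ 2. Along every sequence of meshes that are quasi-equidistributing with the same constant $\kappa$ and whose numbers of cells $N$ tend to infinity, $$\lim_{N\to\infty}\sqrt{\alpha_h}=\|r\|_{L^{2/3}(\Omega)}.$$ 3. If moreover $r'\in L^1(\Omega)$, then for every mesh that is quasi-equidistributing with constant $\kappa$ and satisfies $N>\kappa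 c_1$, $$\Big(1+\Big(\frac{\kappa c_1}{N}\Big)^{2/3}\Big)^{-3/2}\|r\|_{L^{2/3}(\Omega)}\le\sqrt{\alpha_h}\le\Big(1-\Big(\frac{\kappa c_1}{N}\Big)^{2/3}\Big)^{-3/2}\Big[\|r\|_{L^{2/3}(\Omega)}^{2/3}+\Big(\frac{\kappa c_1\|r'\|_{L^1(\Omega)}}{N}\Big)^{2/3}\Big]^{3/2}.$$ -/

import Mathlib

open MeasureTheory Filter Topology Set
open scoped ENNReal ContDiff

noncomputable section

namespace AdaptiveFEM

/-- The domain `Ω = (0, 1)`. -/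
def Omega : Set ℝ := Ioo 0 1

/-- Lebesgue measure on `Ω`. -/
abbrev muOmega : Measure ℝ := volume.restrict Omega

/-- The `L^p(Ω)` norm (a quasi-norm when `p < 1`). -/
def normLp (p : ℝ≥0∞) (v : ℝ → ℝ) : ℝ := (eLpNorm v p muOmega).toReal

/-- Smooth functions with compact support contained in `Ω`. -/
structure IsTestFunction (φ : ℝ → ℝ) : Prop where
  smooth : ContDiff ℝ ∞ φ
  compact : HasCompactSupport φ
  support : tsupport φ ⊆ Omega

/-- `w` is a weak derivative of `v` on `Ω`. -/
structure HasWeakDeriv (v w : ℝ → ℝ) : Prop where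
  locInt : LocallyIntegrableOn v Omega
  locInt_deriv : LocallyIntegrableOn w Omega
  integral_eq : ∀ φ : ℝ → ℝ, IsTestFunction φ →
    ∫ x in Omega, v x * deriv φ x = -∫ x in Omega, w x * φ x

open Classical in
/-- The weak derivative `v'` of `v` on `Ω` (unique up to a null set; by convention `0` if `v` has
no weak derivative). -/
def weakDeriv (v : ℝ → ℝ) : ℝ → ℝ :=
  if h : ∃ w, HasWeakDeriv v w then h.choose else 0

/-- The Sobolev space `W^{1,p}(Ω)`; `p = 2` gives `H¹(Ω)`. -/
def MemW1 (p : ℝ≥0∞) (v : ℝ → ℝ) : Prop :=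
  MemLp v p muOmega ∧ ∃ w, HasWeakDeriv v w ∧ MemLp w p muOmega

/-- The space `V = H¹₀(Ω)`: the closure of the test functions in `H¹(Ω)`. -/
def MemH10 (v : ℝ → ℝ) : Prop :=
  MemW1 2 v ∧ ∃ φ : ℕ → ℝ → ℝ, (∀ n, IsTestFunction (φ n)) ∧
    Tendsto (fun n => eLpNorm (φ n - v) 2 muOmega) atTop (𝓝 0) ∧
    Tendsto (fun n => eLpNorm (deriv (φ n) - weakDeriv v) 2 muOmega) atTop (𝓝 0)

/-- The assumptions on the coefficients `a, b, c` of `-(a u')' + b u' + c u = f`. -/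
structure Coefficients (a₀ : ℝ) (a b c : ℝ → ℝ) : Prop where
  pos : 0 < a₀
  a_mem : MemW1 ∞ a
  b_mem : MemW1 ∞ b
  c_mem : MemLp c ∞ muOmega
  elliptic : ∀ᵐ x ∂muOmega, a₀ ≤ a x
  coercive : ∀ᵐ x ∂muOmega, 0 ≤ c x - 1 / 2 * weakDeriv b x

/-- The bilinear form `B(u, v) = ∫_Ω (a u' v' + b u' v + c u v) dx`. -/
def bilin (a b c u v : ℝ → ℝ) : ℝ :=
  ∫ x in Omega, (a x * weakDeriv u x * weakDeriv v x + b x * weakDeriv u x * v x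
    + c x * u x * v x)

/-- The pairing `(f, v) = ∫_Ω f v dx`. -/
def pairing (f v : ℝ → ℝ) : ℝ := ∫ x in Omega, f x * v x

/-- `u` solves the variational problem: `u ∈ V` and `B(u, v) = (f, v)` for all `v ∈ V`. -/
def IsWeakSolution (a b c f u : ℝ → ℝ) : Prop :=
  MemH10 u ∧ ∀ v, MemH10 v → bilin a b c u v = pairing f v

/-- The residual `f + a' w' - b w' - c w` of a function `w`. For `w = u` this is `r`, for
`w = u_h` it is `r_h` (as `u_h'' = 0` in each cell). -/
def pdeResidual (a b c f w : ℝ → ℝ) : ℝ → ℝ := fun x =>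
  f x + weakDeriv a x * weakDeriv w x - b x * weakDeriv w x - c x * w x

/-- A mesh `0 = x₀ < x₁ < ⋯ < x_N = 1` with `N` cells. Only `x 0, …, x N` are meaningful. -/
structure Mesh (N : ℕ) where
  x : ℕ → ℝ
  x_zero : x 0 = 0
  x_last : x N = 1
  x_lt : ∀ i < N, x i < x (i + 1)

namespace Mesh

variable {N : ℕ} (π : Mesh N)

/-- The cells are numbered from `0`: for `i < N` the cell `i` is `(x i, x (i + 1))`. -/
def cell (i : ℕ) : Set ℝ := Ioo (π.x i) (π.x (i + 1))

/-- The length of the cell `i`. -/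
def len (i : ℕ) : ℝ := π.x (i + 1) - π.x i

/-- The linear basis function (hat function) of the interior mesh point `x i`, `0 < i < N`. -/
def hat (i : ℕ) : ℝ → ℝ := fun t =>
  max 0 (min ((t - π.x (i - 1)) / (π.x i - π.x (i - 1)))
    ((π.x (i + 1) - t) / (π.x (i + 1) - π.x i)))

/-- The linear finite element space `V_h`, the span of the hat functions at interior points. -/
def feSpace : Submodule ℝ (ℝ → ℝ) := Submodule.span ℝ (π.hat '' Ioo 0 N)

/-- `u_h` is the linear finite element solution on the mesh. -/
def IsFESolution (a b c f uh : ℝ → ℝ) : Prop :=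
  uh ∈ π.feSpace ∧ ∀ v ∈ π.feSpace, bilin a b c uh v = pairing f v

/-- The `L²` average of a function `v` over the cell `i`. -/
def avg (v : ℝ → ℝ) (i : ℕ) : ℝ :=
  Real.sqrt (1 / π.len i * ∫ x in π.cell i, |v x| ^ 2)

/-- The intensity parameter `α_h = (∑ h_i ⟨r_h⟩_i^{2/3})³` belonging to the residual `rh`. -/
def alpha (rh : ℝ → ℝ) : ℝ :=
  (∑ i ∈ Finset.range N, π.len i * π.avg rh i ^ (2 / 3 : ℝ)) ^ 3

/-- The value `ρ_i = (1 + ⟨r_h⟩_i² / α_h)^{1/3}` of the adaptation function in the cell `i`. If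
`α_h = 0`, then `⟨r_h⟩_i = 0` for all `i`, and `ρ_i = 1`. -/
def rho (rh : ℝ → ℝ) (i : ℕ) : ℝ :=
  (1 + 1 / π.alpha rh * π.avg rh i ^ 2) ^ (1 / 3 : ℝ)

/-- `σ_h = ∑ ρ_i h_i`. -/
def sigma (rh : ℝ → ℝ) : ℝ := ∑ i ∈ Finset.range N, π.rho rh i * π.len i

/-- The mesh is quasi-equidistributing with constant `κ` for the adaptation function built from
the residual `rh`: `N ρ_i h_i / σ_h ≤ κ` for all `i`. -/
def IsQuasiEquidistributing (rh : ℝ → ℝ) (κ : ℝ) : Prop :=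
  ∀ i < N, N * π.rho rh i * π.len i / π.sigma rh ≤ κ

end Mesh

end AdaptiveFEM

end

open AdaptiveFEM

/-!
Integrating the equation once, the residual functional of a function with derivative `w` takes the
form `v ↦ ∫ P v'` with `P = -a w - ∫₀ˣ (f - b w - c ∫ w)`. For the weak solution `P` is constant, by
the lemma of du Bois-Reymond. For the finite element solution, Galerkin orthogonality against the
hat functions, whose slopes are differences of normalized indicators of adjacent cells, says that
the mean of `P` is the same number `K` on every cell. Inside a cell `P' = -r_h`, so the potential
`R = P - K` satisfies `|R| ≤ ∫ |r_h| ≤ h_i ⟨r_h⟩_i` there.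

The derivative of the error solves the once-integrated equation with potential `R`. Coercivity gives
`‖(u - u_h)'‖ ≤ C ‖R‖_{L²}`, and solving the equation pointwise gives
`|r - r_h| ≤ C (|R| + ‖R‖_{L¹})`, both with constants depending on the coefficients only.

Since `σ_h ≤ 2`, quasi-equidistribution yields `h_i ≤ 2κ/N` and
`h_i ⟨r_h⟩_i^{2/3} ≤ (2κ/N) α_h^{1/3}`. Summed over the cells, these turn the first estimate into
the error bound and the second into `∑ h_i ⟨r - r_h⟩_i^{2/3} ≤ (κ c₁/N)^{2/3} α_h^{1/3}`. By
subadditivity of `t^{2/3}`, `α_h^{1/3}` is then close to `∑ h_i ⟨r⟩_i^{2/3}`, which tends to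
`∫ |r|^{2/3}` and differs from it by an oscillation term controlled by `‖r'‖_{L¹}` when `r' ∈ L¹`.
-/

namespace AdaptiveFEM

/-! ### Primitives -/

/-- The primitive of `w` that vanishes at `0`. Elements of `H¹₀(Ω)` are handled through their
derivatives, as the functions `prim w` with `prim w 1 = 0`. -/
noncomputable def prim (w : ℝ → ℝ) (x : ℝ) : ℝ := ∫ t in (0 : ℝ)..x, w t

theorem measurableSet_Omega : MeasurableSet Omega := measurableSet_Ioo

instance isProbabilityMeasure_muOmega : IsProbabilityMeasure muOmega :=
  ⟨by simp [Omega]⟩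

theorem ae_mem_Omega : ∀ᵐ x ∂muOmega, x ∈ Omega := ae_restrict_mem measurableSet_Omega

theorem Omega_subset_Icc : Omega ⊆ Icc 0 1 := Ioo_subset_Icc_self

theorem zero_mem_unitInterval : (0 : ℝ) ∈ Icc (0 : ℝ) 1 := ⟨le_rfl, zero_le_one⟩

theorem one_mem_unitInterval : (1 : ℝ) ∈ Icc (0 : ℝ) 1 := ⟨zero_le_one, le_rfl⟩

section Prim

variable {g h v w : ℝ → ℝ} {s t x : ℝ}

theorem intervalIntegrable_iff_integrable_muOmega :
    IntervalIntegrable w volume 0 1 ↔ Integrable w muOmega :=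
  intervalIntegrable_iff_integrableOn_Ioo_of_le zero_le_one

theorem intervalIntegrable_of_integrable (hw : Integrable w muOmega)
    (hs : s ∈ Icc (0 : ℝ) 1) (ht : t ∈ Icc (0 : ℝ) 1) : IntervalIntegrable w volume s t := by
  refine (intervalIntegrable_iff_integrable_muOmega.2 hw).mono_set ?_
  rw [uIcc_of_le (zero_le_one (α := ℝ))]
  exact uIcc_subset_Icc hs ht

theorem integral_Omega (w : ℝ → ℝ) : ∫ x in Omega, w x = prim w 1 := by
  rw [prim, intervalIntegral.integral_of_le zero_le_one, integral_Ioc_eq_integral_Ioo, Omega]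

@[simp] theorem prim_zero_right (w : ℝ → ℝ) : prim w 0 = 0 := intervalIntegral.integral_same

theorem prim_sub_prim (hw : Integrable w muOmega) (hs : s ∈ Icc (0 : ℝ) 1)
    (ht : t ∈ Icc (0 : ℝ) 1) : prim w t - prim w s = ∫ x in s..t, w x :=
  intervalIntegral.integral_interval_sub_left
    (intervalIntegrable_of_integrable hw zero_mem_unitInterval ht)
    (intervalIntegrable_of_integrable hw zero_mem_unitInterval hs)

theorem prim_congr (h : v =ᵐ[muOmega] w) (hx : x ∈ Icc (0 : ℝ) 1) : prim v x = prim w x := by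
  rw [prim, prim, intervalIntegral.integral_of_le hx.1, intervalIntegral.integral_of_le hx.1,
    integral_Ioc_eq_integral_Ioo, integral_Ioc_eq_integral_Ioo]
  exact integral_congr_ae (ae_restrict_of_ae_restrict_of_subset (Ioo_subset_Ioo_right hx.2) h)

theorem prim_add (hv : Integrable v muOmega) (hw : Integrable w muOmega)
    (hx : x ∈ Icc (0 : ℝ) 1) : prim (fun t => v t + w t) x = prim v x + prim w x :=
  intervalIntegral.integral_add (intervalIntegrable_of_integrable hv zero_mem_unitInterval hx)
    (intervalIntegrable_of_integrable hw zero_mem_unitInterval hx)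

theorem prim_sub (hv : Integrable v muOmega) (hw : Integrable w muOmega)
    (hx : x ∈ Icc (0 : ℝ) 1) : prim (fun t => v t - w t) x = prim v x - prim w x :=
  intervalIntegral.integral_sub (intervalIntegrable_of_integrable hv zero_mem_unitInterval hx)
    (intervalIntegrable_of_integrable hw zero_mem_unitInterval hx)

theorem prim_const_mul (k : ℝ) (w : ℝ → ℝ) (x : ℝ) :
    prim (fun t => k * w t) x = k * prim w x :=
  intervalIntegral.integral_const_mul k w

theorem abs_prim_le (hw : Integrable w muOmega) (hx : x ∈ Icc (0 : ℝ) 1) :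
    |prim w x| ≤ ∫ x in Omega, |w x| := by
  rw [prim, intervalIntegral.integral_of_le hx.1, integral_Ioc_eq_integral_Ioo]
  exact (abs_integral_le_integral_abs).trans <| setIntegral_mono_set hw.abs
    (ae_of_all _ fun _ => abs_nonneg _) (Ioo_subset_Ioo_right hx.2).eventuallyLE

theorem absolutelyContinuousOnInterval_prim (hw : Integrable w muOmega)
    (hx : x ∈ Icc (0 : ℝ) 1) : AbsolutelyContinuousOnInterval (prim w) 0 x :=
  (intervalIntegrable_of_integrable hw zero_mem_unitInterval hx)
    |>.absolutelyContinuousOnInterval_intervalIntegral left_mem_uIcc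

theorem continuousOn_prim (hw : Integrable w muOmega) : ContinuousOn (prim w) (Icc 0 1) := by
  rw [← uIcc_of_le zero_le_one]
  exact (absolutelyContinuousOnInterval_prim hw one_mem_unitInterval).continuousOn

theorem memLp_top_prim (hw : Integrable w muOmega) : MemLp (prim w) ∞ muOmega :=
  memLp_top_of_bound
    (((continuousOn_prim hw).mono Omega_subset_Icc).aestronglyMeasurable measurableSet_Omega)
    (∫ x in Omega, |w x|) (ae_mem_Omega.mono fun _ hx => abs_prim_le hw (Omega_subset_Icc hx))

theorem memLp_top_const_add_prim (hg : Integrable g muOmega) (k : ℝ) :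
    MemLp (fun x => k + prim g x) ∞ muOmega :=
  (memLp_const k).add (memLp_top_prim hg)

theorem ae_hasDerivAt_prim (hw : Integrable w muOmega) :
    ∀ᵐ x ∂muOmega, HasDerivAt (prim w) (w x) x := by
  have h := (intervalIntegrable_iff_integrable_muOmega.2 hw).ae_hasDerivAt_integral
  rw [ae_restrict_iff' measurableSet_Omega]
  filter_upwards [h] with x hx hxO
  rw [uIcc_of_le zero_le_one] at hx
  exact hx (Omega_subset_Icc hxO) 0 zero_mem_unitInterval

theorem prim_product (hg : Integrable g muOmega) (hh : Integrable h muOmega) (k l : ℝ)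
    (hx : x ∈ Icc (0 : ℝ) 1) :
    prim (fun t => g t * (l + prim h t) + (k + prim g t) * h t) x
      = (k + prim g x) * (l + prim h x) - k * l := by
  have hconst (m : ℝ) : AbsolutelyContinuousOnInterval (fun _ : ℝ => m) 0 x :=
    (contDiff_const.contDiffOn (n := 1)).absolutelyContinuousOnInterval
  have hFG := ((hconst k).add (absolutelyContinuousOnInterval_prim hg hx)).integral_deriv_mul_eq_sub
    ((hconst l).add (absolutelyContinuousOnInterval_prim hh hx))
  simp only [Pi.add_apply, prim_zero_right, add_zero] at hFG
  rw [← hFG]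
  refine prim_congr ?_ hx
  filter_upwards [ae_hasDerivAt_prim hg, ae_hasDerivAt_prim hh] with t h1 h2
  rw [((hasDerivAt_const t k).add h1).deriv, ((hasDerivAt_const t l).add h2).deriv, zero_add,
    zero_add]

theorem integral_prim_mul (hg : Integrable g muOmega) (hh : Integrable h muOmega) (k l : ℝ) :
    ∫ x in Omega, (k + prim g x) * h x
      = (k + prim g 1) * (l + prim h 1) - k * l - ∫ x in Omega, g x * (l + prim h x) := by
  have h1 : Integrable (fun x => g x * (l + prim h x)) muOmega :=
    hg.mul_of_top_left (memLp_top_const_add_prim hh l)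
  have h2 : Integrable (fun x => (k + prim g x) * h x) muOmega :=
    hh.mul_of_top_right (memLp_top_const_add_prim hg k)
  rw [← prim_product hg hh k l one_mem_unitInterval, prim_add h1 h2 one_mem_unitInterval,
    integral_Omega, integral_Omega, add_sub_cancel_left]

end Prim

/-! ### Weak derivatives -/

namespace IsTestFunction

variable {φ ψ : ℝ → ℝ}

theorem eq_zero_of_notMem (h : IsTestFunction φ) {x : ℝ} (hx : x ∉ Omega) : φ x = 0 :=
  image_eq_zero_of_notMem_tsupport fun hx' => hx (h.support hx')

theorem differentiable (h : IsTestFunction φ) : Differentiable ℝ φ :=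
  h.smooth.differentiable (by simp)

theorem deriv (h : IsTestFunction φ) : IsTestFunction (deriv φ) where
  smooth := (contDiff_infty_iff_deriv.1 h.smooth).2
  compact := h.compact.deriv
  support := Subset.trans tsupport_deriv_subset h.support

theorem memLp_top (h : IsTestFunction φ) : MemLp φ ∞ muOmega :=
  (h.smooth.continuous.memLp_top_of_hasCompactSupport h.compact volume).restrict _

theorem integrable (h : IsTestFunction φ) : Integrable φ muOmega :=
  h.memLp_top.integrable le_top

theorem prim_deriv (h : IsTestFunction φ) (x : ℝ) : prim (_root_.deriv φ) x = φ x := by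
  have h0 : φ 0 = 0 := h.eq_zero_of_notMem (by simp [Omega])
  rw [prim, intervalIntegral.integral_eq_sub_of_hasDerivAt
    (fun x _ => (h.differentiable x).hasDerivAt)
    (h.deriv.smooth.continuous.intervalIntegrable _ _), h0, sub_zero]

theorem sub (hφ : IsTestFunction φ) (hψ : IsTestFunction ψ) :
    IsTestFunction (fun x => φ x - ψ x) where
  smooth := hφ.smooth.sub hψ.smooth
  compact := hφ.compact.sub hψ.compact
  support := (tsupport_sub φ ψ).trans (union_subset hφ.support hψ.support)

theorem const_mul (hφ : IsTestFunction φ) (k : ℝ) : IsTestFunction (fun x => k * φ x) where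
  smooth := contDiff_const.mul hφ.smooth
  compact := hφ.compact.mul_left
  support := (closure_mono fun _ hx => right_ne_zero_of_mul hx).trans hφ.support

theorem exists_tsupport_subset_Icc (h : IsTestFunction φ) :
    ∃ s t : ℝ, 0 < s ∧ t < 1 ∧ tsupport φ ⊆ Icc s t := by
  rcases (tsupport φ).eq_empty_or_nonempty with he | hne
  · exact ⟨1 / 2, 1 / 2, by norm_num, by norm_num, by simp [he]⟩
  · obtain ⟨s, hs⟩ := h.compact.isCompact.exists_isLeast hne
    obtain ⟨t, ht⟩ := h.compact.isCompact.exists_isGreatest hne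
    exact ⟨s, t, (h.support hs.1).1, (h.support ht.1).2, fun x hx => ⟨hs.2 hx, ht.2 hx⟩⟩

end IsTestFunction

theorem prim_eq_zero_of_notMem_Icc {w : ℝ → ℝ} {s t x : ℝ} (hs : 0 < s) (ht : t < 1)
    (hw : Function.support w ⊆ Icc s t) (h1 : prim w 1 = 0) (hx : x ∉ Icc s t) :
    prim w x = 0 := by
  rcases lt_or_ge x s with hxs | hsx
  · refine intervalIntegral.integral_zero_ae (ae_of_all _ fun y hy => ?_)
    refine Function.notMem_support.1 fun hy' => ?_
    exact ((uIoc_subset_uIcc hy).2.trans_lt (max_lt hs hxs)).not_ge (hw hy').1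
  · have hsub {b : ℝ} (hb : t < b) : Function.support w ⊆ Ioc 0 b := fun y hy =>
      ⟨hs.trans_le (hw hy).1, (hw hy).2.trans hb.le⟩
    have htx : t < x := not_le.1 fun hxt => hx ⟨hsx, hxt⟩
    rw [← h1, prim, prim,
      intervalIntegral.integral_eq_integral_of_support_subset (hsub htx),
      intervalIntegral.integral_eq_integral_of_support_subset (hsub ht)]

theorem IsTestFunction.exists_deriv_eq {ψ : ℝ → ℝ} (hψ : IsTestFunction ψ)
    (h0 : ∫ x in Omega, ψ x = 0) : ∃ φ, IsTestFunction φ ∧ _root_.deriv φ = ψ := by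
  have hcont := hψ.smooth.continuous
  have hder (x : ℝ) : HasDerivAt (prim ψ) (ψ x) x :=
    intervalIntegral.integral_hasDerivAt_right (hcont.intervalIntegrable _ _)
      (hcont.stronglyMeasurableAtFilter _ _) hcont.continuousAt
  have hderiv : _root_.deriv (prim ψ) = ψ := funext fun x => (hder x).deriv
  obtain ⟨s, t, hs, ht, hK⟩ := hψ.exists_tsupport_subset_Icc
  have hzero : ∀ x ∉ Icc s t, prim ψ x = 0 := fun x =>
    prim_eq_zero_of_notMem_Icc hs ht ((subset_tsupport ψ).trans hK)
      (by rw [← integral_Omega, h0])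
  have hsupp : tsupport (prim ψ) ⊆ Icc s t :=
    closure_minimal (fun x hx => by_contra fun h => hx (hzero x h)) isClosed_Icc
  exact ⟨prim ψ,
    { smooth := contDiff_infty_iff_deriv.2
        ⟨fun x => (hder x).differentiableAt, by rw [hderiv]; exact hψ.smooth⟩
      compact := HasCompactSupport.intro isCompact_Icc hzero
      support := hsupp.trans fun x hx => ⟨hs.trans_le hx.1, hx.2.trans_lt ht⟩ }, hderiv⟩

theorem exists_isTestFunction_integral_eq_one :
    ∃ η, IsTestFunction η ∧ ∫ x in Omega, η x = 1 := by
  let b : ContDiffBump (1 / 2 : ℝ) := ⟨1 / 8, 1 / 4, by norm_num, by norm_num⟩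
  have hs : tsupport (b.normed volume) ⊆ Omega := by
    rw [b.tsupport_normed_eq]
    intro x hx
    rw [Metric.mem_closedBall, Real.dist_eq, abs_le] at hx
    simp only [b] at hx
    constructor <;> linarith [hx.1, hx.2]
  refine ⟨b.normed volume, ⟨b.contDiff_normed, b.hasCompactSupport_normed, hs⟩, ?_⟩
  rw [setIntegral_eq_integral_of_forall_compl_eq_zero, b.integral_normed]
  exact fun x hx => image_eq_zero_of_notMem_tsupport fun h => hx (hs h)

theorem IsTestFunction.integrable_locallyIntegrableOn_mul {w φ : ℝ → ℝ} (hφ : IsTestFunction φ)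
    (hw : LocallyIntegrableOn w Omega) : Integrable (fun x => w x * φ x) muOmega := by
  have h1 : IntegrableOn w (tsupport φ) :=
    hw.integrableOn_compact_subset hφ.support hφ.compact.isCompact
  have h2 : IntegrableOn (fun x => w x * φ x) (tsupport φ) :=
    h1.mul_continuousOn hφ.smooth.continuous.continuousOn hφ.compact.isCompact
  refine ((integrableOn_iff_integrable_of_support_subset ?_).1 h2).restrict
  intro x hx
  exact subset_tsupport _ fun h => hx (by simp [h])

theorem ae_eq_zero_of_integral_test {d : ℝ → ℝ} (hd : LocallyIntegrableOn d Omega)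
    (h : ∀ φ, IsTestFunction φ → ∫ x in Omega, d x * φ x = 0) : ∀ᵐ x ∂muOmega, d x = 0 := by
  rw [ae_restrict_iff' measurableSet_Omega]
  refine isOpen_Ioo.ae_eq_zero_of_integral_contDiff_smul_eq_zero hd fun g hg hgc hgs => ?_
  have hφ : IsTestFunction g := ⟨hg, hgc, hgs⟩
  rw [← h g hφ, setIntegral_eq_integral_of_forall_compl_eq_zero]
  · simp [mul_comm]
  · intro x hx
    simp [hφ.eq_zero_of_notMem hx]

theorem HasWeakDeriv.ae_unique {v v' w w' : ℝ → ℝ} (h : HasWeakDeriv v w)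
    (h' : HasWeakDeriv v' w') (hv : v =ᵐ[muOmega] v') : w =ᵐ[muOmega] w' := by
  have := ae_eq_zero_of_integral_test (h.locInt_deriv.sub h'.locInt_deriv) fun φ hφ => by
    have e1 := h.integral_eq φ hφ
    have e2 := h'.integral_eq φ hφ
    have e3 : ∫ x in Omega, v x * _root_.deriv φ x = ∫ x in Omega, v' x * _root_.deriv φ x :=
      integral_congr_ae (hv.mono fun x hx => by simp only [hx])
    simp only [Pi.sub_apply, sub_mul]
    rw [integral_sub (hφ.integrable_locallyIntegrableOn_mul h.locInt_deriv)
      (hφ.integrable_locallyIntegrableOn_mul h'.locInt_deriv)]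
    linarith
  filter_upwards [this] with x hx
  simpa [sub_eq_zero] using hx

theorem HasWeakDeriv.hasWeakDeriv_weakDeriv {v w : ℝ → ℝ} (h : HasWeakDeriv v w) :
    HasWeakDeriv v (weakDeriv v) := by
  have hex : ∃ w, HasWeakDeriv v w := ⟨w, h⟩
  rw [weakDeriv, dif_pos hex]
  exact hex.choose_spec

theorem HasWeakDeriv.weakDeriv_ae_eq {v w : ℝ → ℝ} (h : HasWeakDeriv v w) :
    weakDeriv v =ᵐ[muOmega] w :=
  h.hasWeakDeriv_weakDeriv.ae_unique h EventuallyEq.rfl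

theorem MemW1.hasWeakDeriv {p : ℝ≥0∞} {v : ℝ → ℝ} (h : MemW1 p v) :
    HasWeakDeriv v (weakDeriv v) :=
  h.2.choose_spec.1.hasWeakDeriv_weakDeriv

theorem MemW1.memLp_weakDeriv {p : ℝ≥0∞} {v : ℝ → ℝ} (h : MemW1 p v) :
    MemLp (weakDeriv v) p muOmega :=
  (memLp_congr_ae h.2.choose_spec.1.weakDeriv_ae_eq).2 h.2.choose_spec.2

theorem hasWeakDeriv_of_ae_eq_prim {v w : ℝ → ℝ} {k : ℝ} (hw : Integrable w muOmega)
    (hv : ∀ᵐ x ∂muOmega, v x = k + prim w x) : HasWeakDeriv v w where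
  locInt := by
    have h : Integrable v muOmega :=
      ((memLp_top_const_add_prim hw k).integrable le_top).congr (hv.mono fun x hx => hx.symm)
    exact IntegrableOn.locallyIntegrableOn h
  locInt_deriv := IntegrableOn.locallyIntegrableOn hw
  integral_eq φ hφ := by
    have h1 := integral_prim_mul hw hφ.deriv.integrable k 0
    simp only [hφ.prim_deriv, hφ.eq_zero_of_notMem (x := 1) (by simp [Omega])] at h1
    rw [integral_congr_ae (hv.mono fun x hx => show _ = (k + prim w x) * _root_.deriv φ x by
      rw [hx]), h1]
    simp [mul_comm]

theorem ae_eq_const_of_integral_mul_deriv_eq_zero {z : ℝ → ℝ} (hz : LocallyIntegrableOn z Omega)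
    (h : ∀ φ, IsTestFunction φ → ∫ x in Omega, z x * deriv φ x = 0) :
    ∃ k, ∀ᵐ x ∂muOmega, z x = k := by
  obtain ⟨η, hη, hη1⟩ := exists_isTestFunction_integral_eq_one
  set k := ∫ x in Omega, z x * η x
  have hk : LocallyIntegrableOn (fun _ : ℝ => k) Omega := locallyIntegrableOn_const k
  have hzero (ψ : ℝ → ℝ) (hψ : IsTestFunction ψ) : ∫ x in Omega, (z x - k) * ψ x = 0 := by
    -- `ψ - m η` has mean zero, so it is the derivative of a test function
    set m := ∫ x in Omega, ψ x
    have hmean : ∫ x in Omega, (ψ x - m * η x) = 0 := by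
      rw [integral_sub hψ.integrable (hη.integrable.const_mul m), integral_const_mul, hη1,
        mul_one, sub_self]
    obtain ⟨φ, hφ, hφd⟩ := (hψ.sub (hη.const_mul m)).exists_deriv_eq hmean
    have horth := h φ hφ
    rw [hφd] at horth
    have hzψ := hψ.integrable_locallyIntegrableOn_mul hz
    have hzη := (hη.integrable_locallyIntegrableOn_mul hz).const_mul m
    calc ∫ x in Omega, (z x - k) * ψ x = (∫ x in Omega, z x * ψ x) - k * m := by
          simp only [sub_mul]
          rw [integral_sub hzψ (hψ.integrable.const_mul k), integral_const_mul]
      _ = (∫ x in Omega, z x * ψ x) - ∫ x in Omega, m * (z x * η x) := by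
          rw [integral_const_mul, mul_comm k]
      _ = ∫ x in Omega, z x * (ψ x - m * η x) := by
          rw [← integral_sub hzψ hzη]
          exact integral_congr_ae (ae_of_all _ fun x => by ring)
      _ = 0 := horth
  exact ⟨k, (ae_eq_zero_of_integral_test (hz.sub hk) hzero).mono fun x hx => sub_eq_zero.1 hx⟩

theorem HasWeakDeriv.exists_ae_eq_prim {v w : ℝ → ℝ} (h : HasWeakDeriv v w)
    (hw : Integrable w muOmega) : ∃ k, ∀ᵐ x ∂muOmega, v x = k + prim w x := by
  have hprim := hasWeakDeriv_of_ae_eq_prim (v := prim w) (k := 0) hw (by simp)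
  obtain ⟨k, hk⟩ := ae_eq_const_of_integral_mul_deriv_eq_zero (h.locInt.sub hprim.locInt)
    fun φ hφ => by
      simp only [Pi.sub_apply, sub_mul]
      rw [integral_sub (hφ.deriv.integrable_locallyIntegrableOn_mul h.locInt)
        (hφ.deriv.integrable_locallyIntegrableOn_mul hprim.locInt), h.integral_eq φ hφ,
        hprim.integral_eq φ hφ, sub_self]
  exact ⟨k, hk.mono fun x hx => eq_add_of_sub_eq hx⟩

theorem IsTestFunction.hasWeakDeriv {φ : ℝ → ℝ} (hφ : IsTestFunction φ) :
    HasWeakDeriv φ (_root_.deriv φ) :=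
  hasWeakDeriv_of_ae_eq_prim (k := 0) hφ.deriv.integrable (by simp [hφ.prim_deriv])

theorem IsTestFunction.memH10 {φ : ℝ → ℝ} (hφ : IsTestFunction φ) : MemH10 φ := by
  have hderiv : eLpNorm (_root_.deriv φ - weakDeriv φ) 2 muOmega = 0 := by
    rw [eLpNorm_congr_ae (hφ.hasWeakDeriv.weakDeriv_ae_eq.symm.sub_eq), eLpNorm_zero]
  exact ⟨⟨hφ.memLp_top.mono_exponent le_top, _, hφ.hasWeakDeriv,
    hφ.deriv.memLp_top.mono_exponent le_top⟩, fun _ => φ, fun _ => hφ, by simp,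
    tendsto_const_nhds.congr fun _ => hderiv.symm⟩

theorem integral_abs_le_toReal_eLpNorm {Ω : Type*} [MeasurableSpace Ω] {μ : Measure Ω}
    [IsProbabilityMeasure μ] {g : Ω → ℝ} {p : ℝ≥0∞} (hp : 1 ≤ p) (hg : MemLp g p μ) :
    ∫ x, |g x| ∂μ ≤ (eLpNorm g p μ).toReal := by
  have h1 : ∫ x, |g x| ∂μ = (eLpNorm g 1 μ).toReal := by
    rw [eLpNorm_one_eq_lintegral_enorm]
    exact integral_norm_eq_lintegral_enorm hg.1
  rw [h1]
  exact ENNReal.toReal_mono hg.eLpNorm_ne_top (eLpNorm_le_eLpNorm_of_exponent_le hp hg.1)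

namespace MemH10

variable {v : ℝ → ℝ}

theorem memLp_weakDeriv (h : MemH10 v) : MemLp (weakDeriv v) 2 muOmega := h.1.memLp_weakDeriv

theorem integrable_weakDeriv (h : MemH10 v) : Integrable (weakDeriv v) muOmega :=
  h.memLp_weakDeriv.integrable one_le_two

theorem exists_tendsto_integral_abs (h : MemH10 v) :
    ∃ φ : ℕ → ℝ → ℝ, (∀ n, IsTestFunction (φ n)) ∧
      Tendsto (fun n => ∫ x in Omega, |φ n x - v x|) atTop (𝓝 0) ∧
      Tendsto (fun n => ∫ x in Omega, |deriv (φ n) x - weakDeriv v x|) atTop (𝓝 0) := by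
  have hL1 {g : ℕ → ℝ → ℝ} (hg : ∀ n, MemLp (g n) 2 muOmega)
      (h0 : Tendsto (fun n => eLpNorm (g n) 2 muOmega) atTop (𝓝 0)) :
      Tendsto (fun n => ∫ x in Omega, |g n x|) atTop (𝓝 0) :=
    squeeze_zero (fun n => integral_nonneg fun x => abs_nonneg _)
      (fun n => integral_abs_le_toReal_eLpNorm one_le_two (hg n))
      ((ENNReal.tendsto_toReal ENNReal.zero_ne_top).comp h0)
  have hw := h.memLp_weakDeriv
  obtain ⟨hW, φ, hφ, hφv, hφw⟩ := h
  exact ⟨φ, hφ, hL1 (fun n => ((hφ n).memLp_top.mono_exponent le_top).sub hW.1) hφv,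
    hL1 (fun n => ((hφ n).deriv.memLp_top.mono_exponent le_top).sub hw) hφw⟩

theorem prim_weakDeriv_one (h : MemH10 v) : prim (weakDeriv v) 1 = 0 := by
  obtain ⟨φ, hφ, -, hφw⟩ := h.exists_tendsto_integral_abs
  refine abs_nonpos_iff.1 (ge_of_tendsto hφw (Eventually.of_forall fun n => ?_))
  have hsub := prim_sub (hφ n).deriv.integrable h.integrable_weakDeriv one_mem_unitInterval
  rw [(hφ n).prim_deriv, (hφ n).eq_zero_of_notMem (by simp [Omega]), zero_sub] at hsub
  rw [← abs_neg, ← hsub]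
  exact abs_prim_le ((hφ n).deriv.integrable.sub h.integrable_weakDeriv) one_mem_unitInterval

theorem ae_eq_prim (h : MemH10 v) : ∀ᵐ x ∂muOmega, v x = prim (weakDeriv v) x := by
  have hw := h.integrable_weakDeriv
  have hv : Integrable v muOmega := h.1.1.integrable one_le_two
  obtain ⟨k, hk⟩ := h.1.hasWeakDeriv.exists_ae_eq_prim hw
  obtain ⟨φ, hφ, hφv, hφw⟩ := h.exists_tendsto_integral_abs
  have hle (n : ℕ) : |k| ≤ (∫ x in Omega, |deriv (φ n) x - weakDeriv v x|)
      + ∫ x in Omega, |φ n x - v x| := by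
    have hdiff : Integrable (fun x => |φ n x - v x|) muOmega := ((hφ n).integrable.sub hv).abs
    calc |k| = ∫ _ in Omega, |k| := by simp [Omega]
      _ ≤ ∫ x in Omega, ((∫ y in Omega, |deriv (φ n) y - weakDeriv v y|) + |φ n x - v x|) := by
          refine integral_mono_ae (integrable_const _) ((integrable_const _).add hdiff) ?_
          filter_upwards [hk, ae_mem_Omega] with x hx hxO
          have hsub := prim_sub (hφ n).deriv.integrable hw (Omega_subset_Icc hxO)
          rw [(hφ n).prim_deriv] at hsub
          calc |k| = |(φ n x - prim (weakDeriv v) x) - (φ n x - v x)| := by rw [hx]; congr 1; ring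
            _ ≤ |φ n x - prim (weakDeriv v) x| + |φ n x - v x| := abs_sub _ _
            _ ≤ _ := by
                gcongr
                rw [← hsub]
                exact abs_prim_le ((hφ n).deriv.integrable.sub hw) (Omega_subset_Icc hxO)
      _ = _ := by
          rw [integral_add (integrable_const _) hdiff, integral_const, probReal_univ, one_smul]
  have hk0 : |k| ≤ 0 := ge_of_tendsto (by simpa using hφw.add hφv) (Eventually.of_forall hle)
  exact hk.mono fun x hx => by rw [hx, abs_nonpos_iff.1 hk0, zero_add]

end MemH10

/-! ### Meshes and linear finite elements -/

theorem prim_indicator_Ioo {p q t : ℝ} (hp : 0 ≤ p) (ht : 0 ≤ t) (k : ℝ) :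
    prim ((Ioo p q).indicator fun _ => k) t = k * max 0 (min q t - p) := by
  rw [prim, intervalIntegral.integral_of_le ht, setIntegral_indicator measurableSet_Ioo,
    setIntegral_const, smul_eq_mul, mul_comm]
  have hae : (Ioc 0 t ∩ Ioo p q : Set ℝ) =ᵐ[volume] Ioc p (min q t) := by
    refine ((ae_eq_refl _).inter Ioo_ae_eq_Ioc).trans (Eq.eventuallyEq ?_)
    rw [Ioc_inter_Ioc, max_eq_right hp, min_comm]
  rw [measureReal_congr hae, Real.volume_real_Ioc, max_comm]

theorem max_zero_min_div_eq_sub {p q r : ℝ} (hpq : p < q) (hqr : q < r) (t : ℝ) :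
    max 0 (min ((t - p) / (q - p)) ((r - t) / (r - q)))
      = 1 / (q - p) * max 0 (min q t - p) - 1 / (r - q) * max 0 (min r t - q) := by
  have hqp' : 0 < q - p := sub_pos.2 hpq
  have hrq' : 0 < r - q := sub_pos.2 hqr
  rcases le_total t q with htq | hqt
  · have hle : (t - p) / (q - p) ≤ (r - t) / (r - q) :=
      ((div_le_one hqp').2 (by linarith)).trans ((one_le_div hrq').2 (by linarith))
    rw [min_eq_left hle, min_eq_right htq, min_eq_right (htq.trans hqr.le),
      max_eq_left (sub_nonpos.2 htq), mul_zero, sub_zero,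
      mul_max_of_nonneg _ _ (one_div_pos.2 hqp').le, mul_zero, one_div_mul_eq_div]
  · have hle : (r - t) / (r - q) ≤ (t - p) / (q - p) :=
      ((div_le_one hrq').2 (by linarith)).trans ((one_le_div hqp').2 (by linarith))
    have hramp : (r - min r t) / (r - q) = max 0 ((r - t) / (r - q)) := by
      rw [← max_sub_sub_left, sub_self, ← max_div_div_right hrq'.le, zero_div]
    rw [min_eq_right hle, min_eq_left hqt, max_eq_right hqp'.le,
      max_eq_right (sub_nonneg.2 (le_min hqr.le hqt)), ← hramp]
    field_simp
    ring

namespace Mesh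

variable {N : ℕ} (π : Mesh N)

theorem x_mono {i j : ℕ} (hij : i ≤ j) (hj : j ≤ N) : π.x i ≤ π.x j := by
  induction j, hij using Nat.le_induction with
  | base => rfl
  | succ k _ ih => exact (ih (by omega)).trans (π.x_lt k (by omega)).le

theorem x_mem {i : ℕ} (hi : i ≤ N) : π.x i ∈ Icc (0 : ℝ) 1 :=
  ⟨π.x_zero ▸ π.x_mono (Nat.zero_le i) hi, π.x_last ▸ π.x_mono hi le_rfl⟩

theorem len_pos {i : ℕ} (hi : i < N) : 0 < π.len i := sub_pos.2 (π.x_lt i hi)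

theorem pos (π : Mesh N) : 0 < N := by
  rcases Nat.eq_zero_or_pos N with rfl | h
  · exact absurd (π.x_zero.symm.trans π.x_last) zero_ne_one
  · exact h

theorem sum_len : ∑ i ∈ Finset.range N, π.len i = 1 := by
  simp only [len, Finset.sum_range_sub, π.x_zero, π.x_last, sub_zero]

theorem measurableSet_cell (i : ℕ) : MeasurableSet (π.cell i) := measurableSet_Ioo

theorem cell_subset {i : ℕ} (hi : i < N) : π.cell i ⊆ Omega := fun _ hx =>
  ⟨(π.x_mem hi.le).1.trans_lt hx.1, hx.2.trans_le (π.x_mem (Nat.succ_le_of_lt hi)).2⟩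

theorem disjoint_cell {i j : ℕ} (hij : i ≠ j) (hi : i < N) (hj : j < N) :
    Disjoint (π.cell i) (π.cell j) := by
  rw [Set.disjoint_left]
  rintro x ⟨h1, h2⟩ ⟨h3, h4⟩
  rcases lt_or_gt_of_ne hij with h | h
  · exact (h2.trans_le (π.x_mono h hj.le)).not_ge h3.le
  · exact (h4.trans_le (π.x_mono h hi.le)).not_ge h1.le

theorem integral_cell_eq_intervalIntegral {i : ℕ} (hi : i < N) (g : ℝ → ℝ) :
    ∫ x in π.cell i, g x = ∫ x in π.x i..π.x (i + 1), g x := by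
  rw [intervalIntegral.integral_of_le (π.x_lt i hi).le, integral_Ioc_eq_integral_Ioo, cell]

theorem sum_integral_cell {g : ℝ → ℝ} (hg : Integrable g muOmega) :
    ∑ i ∈ Finset.range N, ∫ x in π.cell i, g x = ∫ x in Omega, g x := by
  rw [Finset.sum_congr rfl fun i hi =>
      π.integral_cell_eq_intervalIntegral (Finset.mem_range.1 hi) g,
    intervalIntegral.sum_integral_adjacent_intervals fun i hi =>
      intervalIntegrable_of_integrable hg (π.x_mem hi.le) (π.x_mem hi),
    π.x_zero, π.x_last, integral_Omega, prim]

/-- `s` is the piecewise constant derivative of the finite element function `v`. -/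
structure IsSlope (v s : ℝ → ℝ) : Prop where
  memLp : MemLp s ∞ muOmega
  const_on_cell : ∀ i < N, ∃ k, ∀ x ∈ π.cell i, s x = k
  eq_prim : ∀ x ∈ Icc (0 : ℝ) 1, v x = prim s x
  prim_one : prim s 1 = 0

/-- The slope of the hat function of the interior mesh point `x i`. -/
noncomputable def hatSlope (i : ℕ) : ℝ → ℝ := fun t =>
  (π.cell (i - 1)).indicator (fun _ => 1 / π.len (i - 1)) t
    - (π.cell i).indicator (fun _ => 1 / π.len i) t

variable {π}

theorem memLp_indicator_cell (i : ℕ) (k : ℝ) :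
    MemLp ((π.cell i).indicator fun _ => k) ∞ muOmega :=
  (memLp_const k).indicator (π.measurableSet_cell i)

theorem exists_indicator_cell_eq {i j : ℕ} (hi : i < N) (hj : j < N) (k : ℝ) :
    ∃ l, ∀ x ∈ π.cell j, (π.cell i).indicator (fun _ => k) x = l := by
  rcases eq_or_ne i j with rfl | hij
  · exact ⟨k, fun x hx => indicator_of_mem hx _⟩
  · exact ⟨0, fun x hx => indicator_of_notMem
      (Set.disjoint_right.1 (π.disjoint_cell hij hi hj) hx) _⟩

theorem prim_hatSlope {i : ℕ} (hi : i ∈ Ioo 0 N) {t : ℝ} (ht : t ∈ Icc (0 : ℝ) 1) :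
    prim (π.hatSlope i) t = π.hat i t := by
  obtain ⟨j, rfl⟩ : ∃ j, i = j + 1 := ⟨i - 1, (Nat.sub_add_cancel hi.1).symm⟩
  have hj : j < N := (Nat.lt_succ_self j).trans hi.2
  unfold hatSlope
  rw [Nat.add_sub_cancel, prim_sub ((memLp_indicator_cell _ _).integrable le_top)
    ((memLp_indicator_cell _ _).integrable le_top) ht]
  unfold cell
  rw [prim_indicator_Ioo (π.x_mem hj.le).1 ht.1, prim_indicator_Ioo (π.x_mem hi.2.le).1 ht.1]
  exact (max_zero_min_div_eq_sub (π.x_lt j hj) (π.x_lt (j + 1) hi.2) t).symm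

theorem hat_one {i : ℕ} (hi : i < N) : π.hat i 1 = 0 :=
  max_eq_left <| (min_le_right _ _).trans <| div_nonpos_of_nonpos_of_nonneg
    (sub_nonpos.2 (π.x_mem hi).2) (π.len_pos hi).le

theorem isSlope_hatSlope {i : ℕ} (hi : i ∈ Ioo 0 N) : π.IsSlope (π.hat i) (π.hatSlope i) where
  memLp := (memLp_indicator_cell _ _).sub (memLp_indicator_cell _ _)
  const_on_cell j hj := by
    obtain ⟨k, hk⟩ := exists_indicator_cell_eq (π := π) ((Nat.sub_le i 1).trans_lt hi.2) hj
      (1 / π.len (i - 1))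
    obtain ⟨l, hl⟩ := exists_indicator_cell_eq (π := π) hi.2 hj (1 / π.len i)
    exact ⟨k - l, fun x hx => by rw [hatSlope, hk x hx, hl x hx]⟩
  eq_prim _ ht := (prim_hatSlope hi ht).symm
  prim_one := by rw [prim_hatSlope hi one_mem_unitInterval, hat_one hi.2]

namespace IsSlope

variable {v w s t : ℝ → ℝ}

theorem integrable (h : π.IsSlope v s) : Integrable s muOmega := h.memLp.integrable le_top

theorem add (hv : π.IsSlope v s) (hw : π.IsSlope w t) :
    π.IsSlope (v + w) (fun x => s x + t x) where
  memLp := hv.memLp.add hw.memLp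
  const_on_cell i hi := by
    obtain ⟨k, hk⟩ := hv.const_on_cell i hi
    obtain ⟨l, hl⟩ := hw.const_on_cell i hi
    exact ⟨k + l, fun x hx => by rw [hk x hx, hl x hx]⟩
  eq_prim x hx := by
    rw [prim_add hv.integrable hw.integrable hx, Pi.add_apply, hv.eq_prim x hx, hw.eq_prim x hx]
  prim_one := by
    rw [prim_add hv.integrable hw.integrable one_mem_unitInterval, hv.prim_one, hw.prim_one,
      add_zero]

theorem const_smul (hv : π.IsSlope v s) (k : ℝ) : π.IsSlope (k • v) (fun x => k * s x) where
  memLp := hv.memLp.const_mul k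
  const_on_cell i hi := by
    obtain ⟨l, hl⟩ := hv.const_on_cell i hi
    exact ⟨k * l, fun x hx => by rw [hl x hx]⟩
  eq_prim x hx := by rw [prim_const_mul, Pi.smul_apply, hv.eq_prim x hx, smul_eq_mul]
  prim_one := by rw [prim_const_mul, hv.prim_one, mul_zero]

end IsSlope

theorem exists_isSlope {v : ℝ → ℝ} (hv : v ∈ π.feSpace) : ∃ s, π.IsSlope v s := by
  induction hv using Submodule.span_induction with
  | mem v hv =>
    obtain ⟨i, hi, rfl⟩ := hv
    exact ⟨_, isSlope_hatSlope hi⟩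
  | zero => exact ⟨0, MemLp.zero, fun _ _ => ⟨0, by simp⟩, by simp [prim], by simp [prim]⟩
  | add v w _ _ hv hw => exact ⟨_, hv.choose_spec.add hw.choose_spec⟩
  | smul k v _ hv => exact ⟨_, hv.choose_spec.const_smul k⟩

end Mesh

/-! ### The integrated equation -/

section Measure

variable {Ω : Type*} [MeasurableSpace Ω] {μ : Measure Ω}

theorem exists_ae_abs_le_of_memLp_top {g : Ω → ℝ} (hg : MemLp g ∞ μ) :
    ∃ M, 0 ≤ M ∧ ∀ᵐ x ∂μ, |g x| ≤ M := by
  have hfin := hg.eLpNorm_lt_top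
  rw [eLpNorm_exponent_top, eLpNormEssSup_lt_top_iff_isBoundedUnder] at hfin
  obtain ⟨M, hM⟩ := hfin
  exact ⟨M, M.2, hM.mono fun _ hx => hx⟩

theorem sq_integral_abs_le [IsProbabilityMeasure μ] {g : Ω → ℝ} (hg : MemLp g 2 μ) :
    (∫ x, |g x| ∂μ) ^ 2 ≤ ∫ x, g x ^ 2 ∂μ := by
  have h := ProbabilityTheory.variance_nonneg |g| μ
  rw [ProbabilityTheory.variance_eq_sub hg.abs] at h
  simpa only [Pi.pow_apply, Pi.abs_apply, sq_abs, sub_nonneg] using h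

end Measure

theorem prim_two_mul_prim_mul_self {w : ℝ → ℝ} {x : ℝ} (hw : Integrable w muOmega)
    (hx : x ∈ Icc (0 : ℝ) 1) : prim (fun t => 2 * (prim w t * w t)) x = prim w x ^ 2 := by
  have h := prim_product hw hw 0 0 hx
  simp only [zero_add, mul_zero, sub_zero] at h
  rw [sq, ← h]
  congr 1 with t
  ring

theorem HasWeakDeriv.integral_mul_prim_mul_self {b b' w : ℝ → ℝ} (hb : HasWeakDeriv b b')
    (hb' : Integrable b' muOmega) (hw : Integrable w muOmega) (h1 : prim w 1 = 0) :
    ∫ x in Omega, prim w x * (b x * w x) = -∫ x in Omega, 1 / 2 * b' x * prim w x ^ 2 := by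
  obtain ⟨k, hk⟩ := hb.exists_ae_eq_prim hb'
  have hW : Integrable (fun x => 2 * (prim w x * w x)) muOmega :=
    (hw.mul_of_top_right (memLp_top_prim hw)).const_mul 2
  have hparts := integral_prim_mul hb' hW k 0
  rw [prim_two_mul_prim_mul_self hw one_mem_unitInterval, h1] at hparts
  have hleft : ∫ x in Omega, (k + prim b' x) * (2 * (prim w x * w x))
      = 2 * ∫ x in Omega, prim w x * (b x * w x) := by
    rw [← integral_const_mul]
    exact integral_congr_ae (hk.mono fun x hx => by simp only [hx]; ring)
  have hright : ∫ x in Omega, b' x * (0 + prim (fun t => 2 * (prim w t * w t)) x)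
      = 2 * ∫ x in Omega, 1 / 2 * b' x * prim w x ^ 2 := by
    rw [← integral_const_mul]
    refine integral_congr_ae (ae_mem_Omega.mono fun x hx => ?_)
    simp only [prim_two_mul_prim_mul_self hw (Omega_subset_Icc hx)]
    ring
  rw [hleft, hright] at hparts
  linarith

/-- The lower order terms `b u' + c u` of the differential operator, for `w = u'`. -/
noncomputable def lowerOrder (b c w : ℝ → ℝ) : ℝ → ℝ := fun x => b x * w x + c x * prim w x

/-- `w = u'` for a solution `u ∈ H¹₀(Ω)` of `-(a u')' + b u' + c u = -R'`, in the form obtained by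
integrating the equation once. The right-hand side is given by its potential `R`. -/
structure IsIntegratedSolution (a b c R w : ℝ → ℝ) : Prop where
  memLp : MemLp w 2 muOmega
  prim_one : prim w 1 = 0
  ae_eq : ∃ k, ∀ᵐ x ∂muOmega, a x * w x = k + R x + prim (lowerOrder b c w) x

theorem IsIntegratedSolution.integrable {a b c R w : ℝ → ℝ} (h : IsIntegratedSolution a b c R w) :
    Integrable w muOmega :=
  h.memLp.integrable one_le_two

namespace Coefficients

variable {a₀ : ℝ} {a b c : ℝ → ℝ}

theorem abs_inv_le (hc : Coefficients a₀ a b c) : ∀ᵐ x ∂muOmega, |(a x)⁻¹| ≤ a₀⁻¹ := by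
  filter_upwards [hc.elliptic] with x hx
  rw [abs_inv, abs_of_pos (hc.pos.trans_le hx)]
  exact inv_anti₀ hc.pos hx

theorem memLp_inv (hc : Coefficients a₀ a b c) : MemLp (fun x => (a x)⁻¹) ∞ muOmega :=
  memLp_top_of_bound hc.a_mem.1.1.aemeasurable.inv.aestronglyMeasurable a₀⁻¹ hc.abs_inv_le

theorem integrable_lowerOrder (hc : Coefficients a₀ a b c) {w : ℝ → ℝ}
    (hw : Integrable w muOmega) : Integrable (lowerOrder b c w) muOmega :=
  (hw.mul_of_top_right hc.b_mem.1).add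
    (((memLp_top_prim hw).integrable le_top).mul_of_top_right hc.c_mem)

theorem prim_lowerOrder_sub (hc : Coefficients a₀ a b c) {v w : ℝ → ℝ} {x : ℝ}
    (hv : Integrable v muOmega) (hw : Integrable w muOmega) (hx : x ∈ Icc (0 : ℝ) 1) :
    prim (lowerOrder b c fun t => v t - w t) x
      = prim (lowerOrder b c v) x - prim (lowerOrder b c w) x := by
  rw [← prim_sub (hc.integrable_lowerOrder hv) (hc.integrable_lowerOrder hw) hx]
  refine prim_congr (ae_mem_Omega.mono fun t ht => ?_) hx
  simp only [lowerOrder, prim_sub hv hw (Omega_subset_Icc ht)]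
  ring

theorem sub_isIntegratedSolution (hc : Coefficients a₀ a b c) {R S v w : ℝ → ℝ}
    (hv : IsIntegratedSolution a b c R v) (hw : IsIntegratedSolution a b c S w) :
    IsIntegratedSolution a b c (fun x => R x - S x) (fun x => v x - w x) where
  memLp := hv.memLp.sub hw.memLp
  prim_one := by
    rw [prim_sub hv.integrable hw.integrable one_mem_unitInterval, hv.prim_one, hw.prim_one,
      sub_zero]
  ae_eq := by
    obtain ⟨k, hk⟩ := hv.ae_eq
    obtain ⟨l, hl⟩ := hw.ae_eq
    refine ⟨k - l, ?_⟩
    filter_upwards [hk, hl, ae_mem_Omega] with x hx hx' hxO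
    rw [mul_sub, hx, hx',
      hc.prim_lowerOrder_sub hv.integrable hw.integrable (Omega_subset_Icc hxO)]
    ring

theorem exists_integral_abs_lowerOrder_le (hc : Coefficients a₀ a b c) :
    ∃ L, 0 ≤ L ∧ ∀ w, Integrable w muOmega →
      ∫ x in Omega, |lowerOrder b c w x| ≤ L * ∫ x in Omega, |w x| := by
  obtain ⟨B, hB0, hB⟩ := exists_ae_abs_le_of_memLp_top hc.b_mem.1
  obtain ⟨M, hM0, hM⟩ := exists_ae_abs_le_of_memLp_top hc.c_mem
  refine ⟨B + M, add_nonneg hB0 hM0, fun w hw => ?_⟩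
  calc ∫ x in Omega, |lowerOrder b c w x|
      ≤ ∫ x in Omega, (B * |w x| + M * ∫ t in Omega, |w t|) := by
        refine integral_mono_ae (hc.integrable_lowerOrder hw).abs
          ((hw.abs.const_mul B).add (integrable_const _)) ?_
        filter_upwards [hB, hM, ae_mem_Omega] with x hBx hMx hxO
        have hprim := abs_prim_le hw (Omega_subset_Icc hxO)
        refine (abs_add_le _ _).trans ?_
        rw [abs_mul, abs_mul]
        gcongr
    _ = (B + M) * ∫ x in Omega, |w x| := by
        rw [integral_add (hw.abs.const_mul B) (integrable_const _), integral_const_mul,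
          integral_const, probReal_univ, one_smul, add_mul]

theorem integral_prim_mul_lowerOrder_nonneg (hc : Coefficients a₀ a b c) {w : ℝ → ℝ}
    (hw : Integrable w muOmega) (h1 : prim w 1 = 0) :
    0 ≤ ∫ x in Omega, prim w x * lowerOrder b c w x := by
  have hb' := hc.b_mem.memLp_weakDeriv
  have hsq : Integrable (fun x => prim w x ^ 2) muOmega :=
    ((memLp_top_prim hw).mono_exponent le_top).integrable_sq
  have hbi : Integrable (fun x => prim w x * (b x * w x)) muOmega :=
    (hw.mul_of_top_right hc.b_mem.1).mul_of_top_right (memLp_top_prim hw)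
  have hci : Integrable (fun x => c x * prim w x ^ 2) muOmega := hsq.mul_of_top_right hc.c_mem
  have hb'i : Integrable (fun x => 1 / 2 * weakDeriv b x * prim w x ^ 2) muOmega :=
    hsq.mul_of_top_right (hb'.const_mul _)
  calc 0 ≤ ∫ x in Omega, (c x - 1 / 2 * weakDeriv b x) * prim w x ^ 2 :=
        integral_nonneg_of_ae (hc.coercive.mono fun x hx => mul_nonneg hx (sq_nonneg _))
    _ = (∫ x in Omega, prim w x * (b x * w x)) + ∫ x in Omega, c x * prim w x ^ 2 := by
        rw [hc.b_mem.hasWeakDeriv.integral_mul_prim_mul_self (hb'.integrable le_top) hw h1,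
          neg_add_eq_sub, ← integral_sub hci hb'i]
        simp only [sub_mul]
    _ = ∫ x in Omega, prim w x * lowerOrder b c w x := by
        rw [← integral_add hbi hci]
        exact integral_congr_ae (ae_of_all _ fun x => by simp only [lowerOrder]; ring)

theorem integral_mul_sq_le (hc : Coefficients a₀ a b c) {R w : ℝ → ℝ}
    (hR : MemLp R 2 muOmega) (h : IsIntegratedSolution a b c R w) :
    a₀ * ∫ x in Omega, w x ^ 2 ≤ ∫ x in Omega, R x * w x := by
  obtain ⟨k, hk⟩ := h.ae_eq
  have hw := h.integrable
  have hg := hc.integrable_lowerOrder hw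
  have hkg : Integrable (fun x => (k + prim (lowerOrder b c w) x) * w x) muOmega :=
    hw.mul_of_top_right (memLp_top_const_add_prim hg k)
  have hRw : Integrable (fun x => R x * w x) muOmega := hR.integrable_mul h.memLp
  have hparts := integral_prim_mul hg hw k 0
  simp only [h.prim_one, zero_add, mul_zero, sub_zero, zero_sub] at hparts
  have hnonneg := hc.integral_prim_mul_lowerOrder_nonneg hw h.prim_one
  have hcomm : ∫ x in Omega, lowerOrder b c w x * prim w x
      = ∫ x in Omega, prim w x * lowerOrder b c w x := by simp only [mul_comm]
  calc a₀ * ∫ x in Omega, w x ^ 2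
      ≤ ∫ x in Omega, a x * w x ^ 2 := by
        rw [← integral_const_mul]
        exact integral_mono_ae (h.memLp.integrable_sq.const_mul _)
          (h.memLp.integrable_sq.mul_of_top_right hc.a_mem.1)
          (hc.elliptic.mono fun x hx => mul_le_mul_of_nonneg_right hx (sq_nonneg _))
    _ = ∫ x in Omega, (R x * w x + (k + prim (lowerOrder b c w) x) * w x) := by
        refine integral_congr_ae (hk.mono fun x hx => ?_)
        simp only [sq, ← mul_assoc, hx]
        ring
    _ = (∫ x in Omega, R x * w x) - ∫ x in Omega, prim w x * lowerOrder b c w x := by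
        rw [integral_add hRw hkg, hparts, hcomm, ← sub_eq_add_neg]
    _ ≤ ∫ x in Omega, R x * w x := sub_le_self _ hnonneg

theorem sq_mul_integral_sq_le (hc : Coefficients a₀ a b c) {R w : ℝ → ℝ}
    (hR : MemLp R 2 muOmega) (h : IsIntegratedSolution a b c R w) :
    a₀ ^ 2 * ∫ x in Omega, w x ^ 2 ≤ ∫ x in Omega, R x ^ 2 := by
  have hyoung : 2 * a₀ * ∫ x in Omega, R x * w x
      ≤ (∫ x in Omega, R x ^ 2) + a₀ ^ 2 * ∫ x in Omega, w x ^ 2 := by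
    rw [← integral_const_mul, ← integral_const_mul,
      ← integral_add hR.integrable_sq (h.memLp.integrable_sq.const_mul _)]
    refine integral_mono ((hR.integrable_mul h.memLp).const_mul _)
      (hR.integrable_sq.add (h.memLp.integrable_sq.const_mul _)) fun x => ?_
    simp only
    nlinarith [sq_nonneg (R x - a₀ * w x)]
  have henergy := mul_le_mul_of_nonneg_left (hc.integral_mul_sq_le hR h) hc.pos.le
  nlinarith

end Coefficients

/-! ### Stability with respect to the potential -/

theorem integral_abs_add_le {Ω : Type*} [MeasurableSpace Ω] {μ : Measure Ω}
    [IsProbabilityMeasure μ] {g h : Ω → ℝ} {K : ℝ} (hg : Integrable g μ) (hh : Integrable h μ)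
    (hK : ∀ᵐ x ∂μ, |h x| ≤ K) : ∫ x, |g x + h x| ∂μ ≤ (∫ x, |g x| ∂μ) + K := by
  calc ∫ x, |g x + h x| ∂μ ≤ ∫ x, (|g x| + K) ∂μ :=
        integral_mono_ae (hg.add hh).abs (hg.abs.add (integrable_const _))
          (hK.mono fun x hx => (abs_add_le _ _).trans (add_le_add le_rfl hx))
    _ = (∫ x, |g x| ∂μ) + K := by
        rw [integral_add hg.abs (integrable_const _), integral_const, probReal_univ, one_smul]

namespace Coefficients

variable {a₀ : ℝ} {a b c : ℝ → ℝ}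

theorem exists_pos_le_integral_inv (hc : Coefficients a₀ a b c) :
    ∃ m, 0 < m ∧ m ≤ ∫ x in Omega, (a x)⁻¹ := by
  obtain ⟨M, hM0, hM⟩ := exists_ae_abs_le_of_memLp_top hc.a_mem.1
  refine ⟨(M + 1)⁻¹, by positivity, ?_⟩
  calc (M + 1)⁻¹ = ∫ _ in Omega, (M + 1)⁻¹ := by
        rw [integral_const, probReal_univ, one_smul]
    _ ≤ ∫ x in Omega, (a x)⁻¹ := by
        refine integral_mono_ae (integrable_const _) (hc.memLp_inv.integrable le_top) ?_
        filter_upwards [hM, hc.elliptic] with x hx hxa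
        exact inv_anti₀ (hc.pos.trans_le hxa) ((le_abs_self _).trans (hx.trans (by linarith)))

theorem exists_abs_const_le (hc : Coefficients a₀ a b c) :
    ∃ A, 0 ≤ A ∧ ∀ (w h : ℝ → ℝ) (k : ℝ), Integrable h muOmega → prim w 1 = 0 →
      (∀ᵐ x ∂muOmega, a x * w x = k + h x) → |k| ≤ A * ∫ x in Omega, |h x| := by
  obtain ⟨m, hm, hm'⟩ := hc.exists_pos_le_integral_inv
  have ha₀ := hc.pos
  refine ⟨m⁻¹ * a₀⁻¹, by positivity, fun w h k hh h1 heq => ?_⟩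
  have hinv : Integrable (fun x => (a x)⁻¹) muOmega := hc.memLp_inv.integrable le_top
  have hinvh : Integrable (fun x => (a x)⁻¹ * h x) muOmega := hh.mul_of_top_right hc.memLp_inv
  have hzero : k * ∫ x in Omega, (a x)⁻¹ = -∫ x in Omega, (a x)⁻¹ * h x := by
    rw [eq_neg_iff_add_eq_zero, ← integral_const_mul, ← integral_add (hinv.const_mul k) hinvh,
      ← h1, ← integral_Omega]
    refine integral_congr_ae ?_
    filter_upwards [heq, hc.elliptic] with x hx hxa
    have hax : a x ≠ 0 := (hc.pos.trans_le hxa).ne'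
    field_simp
    linarith
  rw [mul_assoc, inv_mul_eq_div, le_div_iff₀ hm]
  calc |k| * m ≤ |k| * ∫ x in Omega, (a x)⁻¹ := by gcongr
    _ = |∫ x in Omega, (a x)⁻¹ * h x| := by
        rw [← abs_neg (∫ x in Omega, (a x)⁻¹ * h x), ← hzero, abs_mul,
          abs_of_pos (hm.trans_le hm')]
    _ ≤ ∫ x in Omega, |(a x)⁻¹ * h x| := abs_integral_le_integral_abs
    _ ≤ ∫ x in Omega, a₀⁻¹ * |h x| := by
        refine integral_mono_ae hinvh.abs (hh.abs.const_mul _) (hc.abs_inv_le.mono fun x hx => ?_)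
        simp only [abs_mul]
        gcongr
    _ = a₀⁻¹ * ∫ x in Omega, |h x| := integral_const_mul _ _

theorem exists_abs_le_of_mul_eq_const_add (hc : Coefficients a₀ a b c) :
    ∃ A, 0 ≤ A ∧ ∀ (w h : ℝ → ℝ) (k : ℝ), Integrable h muOmega → prim w 1 = 0 →
      (∀ᵐ x ∂muOmega, a x * w x = k + h x) →
      ∀ᵐ x ∂muOmega, |w x| ≤ A * (|h x| + ∫ t in Omega, |h t|) := by
  obtain ⟨B, hB0, hB⟩ := hc.exists_abs_const_le
  have ha₀ := hc.pos
  refine ⟨a₀⁻¹ * (1 + B), by positivity, fun w h k hh h1 heq => ?_⟩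
  have hk := hB w h k hh h1 heq
  have hJ : 0 ≤ ∫ t in Omega, |h t| := integral_nonneg fun _ => abs_nonneg _
  filter_upwards [heq, hc.elliptic, hc.abs_inv_le] with x hx hxa hxi
  have hw : w x = (a x)⁻¹ * (k + h x) := by
    rw [← hx, inv_mul_cancel_left₀ (hc.pos.trans_le hxa).ne']
  calc |w x| ≤ a₀⁻¹ * |k + h x| := by rw [hw, abs_mul]; gcongr
    _ ≤ a₀⁻¹ * (B * (∫ t in Omega, |h t|) + |h x|) := by
        gcongr
        exact (abs_add_le _ _).trans (by gcongr)
    _ ≤ a₀⁻¹ * ((1 + B) * (|h x| + ∫ t in Omega, |h t|)) := by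
        gcongr
        nlinarith [mul_nonneg hB0 (abs_nonneg (h x))]
    _ = a₀⁻¹ * (1 + B) * (|h x| + ∫ t in Omega, |h t|) := (mul_assoc _ _ _).symm

theorem exists_mul_eq_const_add (hc : Coefficients a₀ a b c) {R : ℝ → ℝ}
    (hR : MemLp R 2 muOmega) :
    ∃ p k, MemLp p 2 muOmega ∧ prim p 1 = 0 ∧ ∀ᵐ x ∂muOmega, a x * p x = k + R x := by
  obtain ⟨m, hm, hm'⟩ := hc.exists_pos_le_integral_inv
  have hinv : Integrable (fun x => (a x)⁻¹) muOmega := hc.memLp_inv.integrable le_top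
  have hinvR : Integrable (fun x => (a x)⁻¹ * R x) muOmega :=
    (hR.integrable one_le_two).mul_of_top_right hc.memLp_inv
  set k := -(∫ x in Omega, (a x)⁻¹ * R x) / ∫ x in Omega, (a x)⁻¹ with hk
  refine ⟨fun x => (a x)⁻¹ * (k + R x), k, ((memLp_const k).add hR).mul hc.memLp_inv, ?_, ?_⟩
  · rw [← integral_Omega]
    simp only [mul_add]
    rw [integral_add (hinv.mul_const k) hinvR, integral_mul_const, hk,
      mul_div_cancel₀ _ (hm.trans_le hm').ne', neg_add_cancel]
  · filter_upwards [hc.elliptic] with x hx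
    rw [mul_inv_cancel_left₀ (hc.pos.trans_le hx).ne']

theorem exists_integral_abs_le_of_potential_prim (hc : Coefficients a₀ a b c) :
    ∃ A, 0 ≤ A ∧ ∀ p d : ℝ → ℝ, Integrable p muOmega →
      IsIntegratedSolution a b c (prim (lowerOrder b c p)) d →
      ∫ x in Omega, |d x| ≤ A * ∫ x in Omega, |p x| := by
  obtain ⟨L, hL0, hL⟩ := hc.exists_integral_abs_lowerOrder_le
  have ha₀ := hc.pos
  refine ⟨a₀⁻¹ * L, by positivity, fun p d hp hd => ?_⟩
  have hg := hc.integrable_lowerOrder hp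
  have hG : MemLp (prim (lowerOrder b c p)) 2 muOmega := (memLp_top_prim hg).mono_exponent le_top
  have hGsq : ∫ x in Omega, prim (lowerOrder b c p) x ^ 2 ≤ (L * ∫ x in Omega, |p x|) ^ 2 := by
    calc ∫ x in Omega, prim (lowerOrder b c p) x ^ 2
        ≤ ∫ _ in Omega, (L * ∫ x in Omega, |p x|) ^ 2 := by
          refine integral_mono_ae hG.integrable_sq (integrable_const _)
            (ae_mem_Omega.mono fun x hx => ?_)
          have hle := (abs_prim_le hg (Omega_subset_Icc hx)).trans (hL p hp)
          exact sq_le_sq' (abs_le.1 hle).1 (abs_le.1 hle).2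
      _ = (L * ∫ x in Omega, |p x|) ^ 2 := by rw [integral_const, probReal_univ, one_smul]
  have hsq : (a₀ * ∫ x in Omega, |d x|) ^ 2 ≤ (L * ∫ x in Omega, |p x|) ^ 2 := by
    calc (a₀ * ∫ x in Omega, |d x|) ^ 2 ≤ a₀ ^ 2 * ∫ x in Omega, d x ^ 2 := by
          rw [mul_pow]
          gcongr
          exact sq_integral_abs_le hd.memLp
      _ ≤ (L * ∫ x in Omega, |p x|) ^ 2 := (hc.sq_mul_integral_sq_le hG hd).trans hGsq
  have hle := le_of_sq_le_sq hsq (by positivity)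
  rwa [mul_assoc, inv_mul_eq_div, le_div_iff₀' ha₀]

/-- The solution `p` of the equation without lower order terms is bounded explicitly; the remainder
`w - p` has a potential bounded by `‖p‖₁`, and the energy estimate applies to it. -/
theorem exists_integral_abs_le (hc : Coefficients a₀ a b c) :
    ∃ A, 0 ≤ A ∧ ∀ R w : ℝ → ℝ, MemLp R 2 muOmega → IsIntegratedSolution a b c R w →
      ∫ x in Omega, |w x| ≤ A * ∫ x in Omega, |R x| := by
  obtain ⟨A, hA0, hA⟩ := hc.exists_abs_le_of_mul_eq_const_add
  obtain ⟨B, hB0, hB⟩ := hc.exists_integral_abs_le_of_potential_prim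
  refine ⟨(1 + B) * (2 * A), by positivity, fun R w hR hw => ?_⟩
  have hRi := hR.integrable one_le_two
  obtain ⟨p, k, hp2, hp1, hp⟩ := hc.exists_mul_eq_const_add hR
  have hpi := hp2.integrable one_le_two
  have hpsol : IsIntegratedSolution a b c (fun x => R x - prim (lowerOrder b c p) x) p :=
    ⟨hp2, hp1, k, hp.mono fun x hx => by rw [hx]; ring⟩
  have hd := hc.sub_isIntegratedSolution hw hpsol
  simp only [sub_sub_cancel] at hd
  have hpR : ∫ x in Omega, |p x| ≤ 2 * A * ∫ x in Omega, |R x| := by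
    calc ∫ x in Omega, |p x| ≤ ∫ x in Omega, A * (|R x| + ∫ t in Omega, |R t|) :=
          integral_mono_ae hpi.abs ((hRi.abs.add (integrable_const _)).const_mul _)
            (hA p R k hRi hp1 hp)
      _ = 2 * A * ∫ x in Omega, |R x| := by
          rw [integral_const_mul, integral_add hRi.abs (integrable_const _), integral_const,
            probReal_univ, one_smul]
          ring
  calc ∫ x in Omega, |w x| ≤ ∫ x in Omega, (|p x| + |w x - p x|) := by
        refine integral_mono hw.integrable.abs (hpi.abs.add hd.integrable.abs) fun x => ?_
        simpa only [add_sub_cancel] using abs_add_le (p x) (w x - p x)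
    _ = (∫ x in Omega, |p x|) + ∫ x in Omega, |w x - p x| :=
        integral_add hpi.abs hd.integrable.abs
    _ ≤ (1 + B) * ∫ x in Omega, |p x| := by
        rw [add_mul, one_mul]
        gcongr
        exact hB p _ hpi hd
    _ ≤ (1 + B) * (2 * A * ∫ x in Omega, |R x|) := by gcongr
    _ = (1 + B) * (2 * A) * ∫ x in Omega, |R x| := (mul_assoc _ _ _).symm

theorem exists_pointwise_stability (hc : Coefficients a₀ a b c) :
    ∃ A, 0 ≤ A ∧ ∀ R w : ℝ → ℝ, MemLp R 2 muOmega → IsIntegratedSolution a b c R w →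
      ∀ᵐ x ∂muOmega, |w x| + |prim w x| ≤ A * (|R x| + ∫ t in Omega, |R t|) := by
  obtain ⟨A, hA0, hA⟩ := hc.exists_abs_le_of_mul_eq_const_add
  obtain ⟨B, hB0, hB⟩ := hc.exists_integral_abs_le
  obtain ⟨L, hL0, hL⟩ := hc.exists_integral_abs_lowerOrder_le
  refine ⟨A * (1 + 2 * (L * B)) + B, by positivity, fun R w hR hw => ?_⟩
  have hRi := hR.integrable one_le_two
  have hg := hc.integrable_lowerOrder hw.integrable
  have hgi := (memLp_top_prim hg).integrable le_top
  set J := ∫ t in Omega, |R t|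
  have hwJ : ∫ x in Omega, |w x| ≤ B * J := hB R w hR hw
  have hgJ : ∀ x ∈ Omega, |prim (lowerOrder b c w) x| ≤ L * B * J := fun x hx => by
    rw [mul_assoc]
    exact (abs_prim_le hg (Omega_subset_Icc hx)).trans ((hL w hw.integrable).trans (by gcongr))
  have hI : ∫ x in Omega, |R x + prim (lowerOrder b c w) x| ≤ J + L * B * J :=
    integral_abs_add_le hRi hgi (ae_mem_Omega.mono hgJ)
  obtain ⟨k, hk⟩ := hw.ae_eq
  have hpoint := hA w _ k (hRi.add hgi) hw.prim_one
    (hk.mono fun x hx => by rw [hx, add_assoc, Pi.add_apply])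
  filter_upwards [hpoint, ae_mem_Omega] with x hx hxO
  calc |w x| + |prim w x|
      ≤ A * (|R x + prim (lowerOrder b c w) x|
          + ∫ t in Omega, |R t + prim (lowerOrder b c w) t|) + ∫ t in Omega, |w t| :=
        add_le_add hx (abs_prim_le hw.integrable (Omega_subset_Icc hxO))
    _ ≤ A * ((|R x| + L * B * J) + (J + L * B * J)) + B * J := by
        gcongr
        exact (abs_add_le _ _).trans (by gcongr; exact hgJ x hxO)
    _ ≤ (A * (1 + 2 * (L * B)) + B) * (|R x| + J) := by
        have hpos : 0 ≤ (A * (2 * (L * B)) + B) * |R x| := by positivity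
        linarith

end Coefficients

/-! ### Averages over the cells of a mesh -/

section Measure

variable {Ω : Type*} [MeasurableSpace Ω] {μ : Measure Ω}

theorem toReal_eLpNorm_eq_integral_rpow {p : ℝ≥0∞} (hp : p ≠ 0) (hp' : p ≠ ⊤) {v : Ω → ℝ}
    (hv : MemLp v p μ) :
    (eLpNorm v p μ).toReal = (∫ x, |v x| ^ p.toReal ∂μ) ^ p.toReal⁻¹ := by
  rw [hv.eLpNorm_eq_integral_rpow_norm hp hp', ENNReal.toReal_ofReal (by positivity)]
  rfl

theorem two_thirds_ne_top : (2 / 3 : ℝ≥0∞) ≠ ⊤ :=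
  ENNReal.div_ne_top ENNReal.ofNat_ne_top three_ne_zero

theorem two_thirds_le_two : (2 / 3 : ℝ≥0∞) ≤ 2 := ENNReal.div_le_of_le_mul (by norm_num)

theorem integral_abs_rpow_two_thirds {v : Ω → ℝ} (hv : MemLp v (2 / 3) μ) :
    ∫ x, |v x| ^ (2 / 3 : ℝ) ∂μ = (eLpNorm v (2 / 3) μ).toReal ^ (2 / 3 : ℝ) := by
  have h := toReal_eLpNorm_eq_integral_rpow (by simp) two_thirds_ne_top hv
  simp only [ENNReal.toReal_div, ENNReal.toReal_ofNat] at h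
  rw [h, Real.rpow_inv_rpow (integral_nonneg fun _ => by positivity) (by norm_num)]

theorem integrable_abs_rpow_two_thirds [IsFiniteMeasure μ] {v : Ω → ℝ} (hv : MemLp v 2 μ) :
    Integrable (fun x => |v x| ^ (2 / 3 : ℝ)) μ := by
  have h := (hv.mono_exponent two_thirds_le_two).integrable_norm_rpow (by simp) two_thirds_ne_top
  simpa only [ENNReal.toReal_div, ENNReal.toReal_ofNat, Real.norm_eq_abs] using h

theorem abs_sub_integral_le [IsProbabilityMeasure μ] {g : Ω → ℝ} {t K : ℝ} (hg : Integrable g μ)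
    (h : ∀ᵐ x ∂μ, |t - g x| ≤ K) : |t - ∫ x, g x ∂μ| ≤ K := by
  calc |t - ∫ x, g x ∂μ| = |∫ x, (t - g x) ∂μ| := by
        rw [integral_sub (integrable_const t) hg, integral_const, probReal_univ, one_smul]
    _ ≤ ∫ x, |t - g x| ∂μ := abs_integral_le_integral_abs
    _ ≤ ∫ _, K ∂μ := integral_mono_ae ((integrable_const t).sub hg).abs (integrable_const K) h
    _ = K := by rw [integral_const, probReal_univ, one_smul]

end Measure

namespace Mesh

variable {N : ℕ} (π : Mesh N)

/-- Normalized Lebesgue measure on the cell `i`, so that `⟨v⟩_i` is the `L²` norm of `v`. -/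
noncomputable def cellMeasure (i : ℕ) : Measure ℝ := ProbabilityTheory.cond volume (π.cell i)

variable {π} {i : ℕ} {v v₁ v₂ : ℝ → ℝ}

theorem isProbabilityMeasure_cellMeasure (hi : i < N) : IsProbabilityMeasure (π.cellMeasure i) :=
  ProbabilityTheory.cond_isProbabilityMeasure_of_finite
    (by simpa [cell] using π.x_lt i hi) (by simp [cell])

theorem integral_cellMeasure (hi : i < N) (g : ℝ → ℝ) :
    ∫ x, g x ∂π.cellMeasure i = 1 / π.len i * ∫ x in π.cell i, g x := by
  have hvol : volume (π.cell i) = ENNReal.ofReal (π.len i) := Real.volume_Ioo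
  rw [cellMeasure, ProbabilityTheory.cond, integral_smul_measure, hvol, ENNReal.toReal_inv,
    ENNReal.toReal_ofReal (π.len_pos hi).le, smul_eq_mul, one_div]

theorem len_mul_integral_cellMeasure (hi : i < N) (g : ℝ → ℝ) :
    π.len i * ∫ x, g x ∂π.cellMeasure i = ∫ x in π.cell i, g x := by
  rw [integral_cellMeasure hi, ← mul_assoc, mul_one_div_cancel (π.len_pos hi).ne', one_mul]

theorem ae_mem_cell (i : ℕ) : ∀ᵐ x ∂π.cellMeasure i, x ∈ π.cell i :=
  ProbabilityTheory.ae_cond_mem (π.measurableSet_cell i)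

theorem ae_cellMeasure (hi : i < N) {p : ℝ → Prop} (h : ∀ᵐ x ∂muOmega, p x) :
    ∀ᵐ x ∂π.cellMeasure i, p x :=
  Measure.ae_smul_measure (ae_restrict_of_ae_restrict_of_subset (π.cell_subset hi) h) _

theorem memLp_cellMeasure {p : ℝ≥0∞} (hi : i < N) (hv : MemLp v p muOmega) :
    MemLp v p (π.cellMeasure i) :=
  (hv.mono_measure (Measure.restrict_mono_set volume (π.cell_subset hi))).smul_measure
    (by simpa [cell] using π.x_lt i hi)

theorem integrable_cellMeasure (hi : i < N) (hv : Integrable v muOmega) :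
    Integrable v (π.cellMeasure i) :=
  memLp_one_iff_integrable.1 (memLp_cellMeasure hi (memLp_one_iff_integrable.2 hv))

theorem abs_prim_sub_prim_le {g : ℝ → ℝ} {x y : ℝ} (hg : Integrable g muOmega) (hi : i < N)
    (hx : x ∈ π.cell i) (hy : y ∈ π.cell i) :
    |prim g x - prim g y| ≤ ∫ t in π.cell i, |g t| := by
  have hxy : uIoc y x ⊆ π.cell i := uIoc_subset_uIcc.trans (ordConnected_Ioo.uIcc_subset hy hx)
  rw [prim_sub_prim hg (Omega_subset_Icc (π.cell_subset hi hy))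
    (Omega_subset_Icc (π.cell_subset hi hx))]
  exact (intervalIntegral.norm_integral_le_integral_norm_uIoc (f := g)).trans <|
    setIntegral_mono_set (IntegrableOn.mono_set (t := Omega) hg.abs (π.cell_subset hi))
      (ae_of_all _ fun _ => abs_nonneg _) hxy.eventuallyLE

theorem ae_ae_abs_sub_le {g T : ℝ → ℝ} {k : ℝ} (hg : Integrable g muOmega) (hi : i < N)
    (hT : ∀ᵐ x ∂π.cellMeasure i, T x = k + prim g x) :
    ∀ᵐ x ∂π.cellMeasure i, ∀ᵐ y ∂π.cellMeasure i, |T x - T y| ≤ ∫ t in π.cell i, |g t| := by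
  filter_upwards [hT, ae_mem_cell i] with x hx hxc
  filter_upwards [hT, ae_mem_cell i] with y hy hyc
  rw [hx, hy, add_sub_add_left_eq_sub]
  exact abs_prim_sub_prim_le hg hi hxc hyc

theorem ae_abs_sub_integral_cellMeasure_le {g T : ℝ → ℝ} {k : ℝ} (hg : Integrable g muOmega)
    (hi : i < N) (hT : ∀ᵐ x ∂π.cellMeasure i, T x = k + prim g x) :
    ∀ᵐ x ∂π.cellMeasure i, |T x - ∫ y, T y ∂π.cellMeasure i| ≤ ∫ t in π.cell i, |g t| := by
  have := isProbabilityMeasure_cellMeasure (π := π) hi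
  have hTi : Integrable T (π.cellMeasure i) :=
    (integrable_cellMeasure hi ((memLp_top_const_add_prim hg k).integrable le_top)).congr
      (hT.mono fun x hx => hx.symm)
  exact (ae_ae_abs_sub_le hg hi hT).mono fun x hx => abs_sub_integral_le hTi hx

theorem avg_nonneg (v : ℝ → ℝ) (i : ℕ) : 0 ≤ π.avg v i := Real.sqrt_nonneg _

theorem avg_eq (hi : i < N) (hv : MemLp v 2 muOmega) :
    π.avg v i = (eLpNorm v 2 (π.cellMeasure i)).toReal := by
  rw [toReal_eLpNorm_eq_integral_rpow (by simp) (by simp) (memLp_cellMeasure hi hv),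
    integral_cellMeasure hi, avg, Real.sqrt_eq_rpow]
  simp

theorem len_mul_avg_sq (hi : i < N) : π.len i * π.avg v i ^ 2 = ∫ x in π.cell i, v x ^ 2 := by
  rw [avg, ← integral_cellMeasure hi, Real.sq_sqrt (integral_nonneg fun _ => by positivity),
    len_mul_integral_cellMeasure hi]
  simp only [sq_abs]

theorem avg_const_mul {k : ℝ} (hk : 0 ≤ k) (v : ℝ → ℝ) (i : ℕ) :
    π.avg (fun x => k * v x) i = k * π.avg v i := by
  simp only [avg, abs_mul, mul_pow, integral_const_mul]
  rw [mul_left_comm, Real.sqrt_mul (by positivity), Real.sqrt_sq (abs_nonneg k), abs_of_nonneg hk]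

theorem avg_le_add (hi : i < N) (hv : MemLp v 2 muOmega) (h1 : MemLp v₁ 2 muOmega)
    (h2 : MemLp v₂ 2 muOmega) (h : ∀ᵐ x ∂muOmega, |v x| ≤ |v₁ x| + |v₂ x|) :
    π.avg v i ≤ π.avg v₁ i + π.avg v₂ i := by
  have k1 := memLp_cellMeasure hi h1 (π := π)
  have k2 := memLp_cellMeasure hi h2 (π := π)
  rw [avg_eq hi hv, avg_eq hi h1, avg_eq hi h2,
    ← ENNReal.toReal_add k1.eLpNorm_ne_top k2.eLpNorm_ne_top]
  refine ENNReal.toReal_mono (ENNReal.add_ne_top.2 ⟨k1.eLpNorm_ne_top, k2.eLpNorm_ne_top⟩) ?_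
  rw [← eLpNorm_norm v₁, ← eLpNorm_norm v₂]
  refine (eLpNorm_mono_ae (g := (fun x => ‖v₁ x‖) + fun x => ‖v₂ x‖) ?_).trans
    (eLpNorm_add_le k1.1.norm k2.1.norm one_le_two)
  exact (ae_cellMeasure hi h).mono fun x hx => hx.trans (le_abs_self _)

theorem avg_le_of_ae_abs_le {k : ℝ} (hi : i < N) (hk : 0 ≤ k)
    (h : ∀ᵐ x ∂π.cellMeasure i, |v x| ≤ k) : π.avg v i ≤ k := by
  have := isProbabilityMeasure_cellMeasure (π := π) hi
  rw [avg, ← integral_cellMeasure hi]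
  refine Real.sqrt_le_iff.2 ⟨hk, ?_⟩
  calc ∫ x, |v x| ^ 2 ∂π.cellMeasure i ≤ ∫ _, k ^ 2 ∂π.cellMeasure i :=
        integral_mono_of_nonneg (ae_of_all _ fun _ => by positivity) (integrable_const _)
          (h.mono fun x hx => pow_le_pow_left₀ (abs_nonneg _) hx 2)
    _ = k ^ 2 := by rw [integral_const, probReal_univ, one_smul]

theorem integral_cell_abs_le (hi : i < N) (hv : MemLp v 2 muOmega) :
    ∫ x in π.cell i, |v x| ≤ π.len i * π.avg v i := by
  have := isProbabilityMeasure_cellMeasure (π := π) hi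
  rw [← len_mul_integral_cellMeasure hi, avg_eq hi hv]
  exact mul_le_mul_of_nonneg_left
    (integral_abs_le_toReal_eLpNorm one_le_two (memLp_cellMeasure hi hv)) (π.len_pos hi).le

theorem integral_cell_rpow_le (hi : i < N) (hv : MemLp v 2 muOmega) :
    ∫ x in π.cell i, |v x| ^ (2 / 3 : ℝ) ≤ π.len i * π.avg v i ^ (2 / 3 : ℝ) := by
  have := isProbabilityMeasure_cellMeasure (π := π) hi
  have hv' := memLp_cellMeasure hi hv (π := π)
  rw [← len_mul_integral_cellMeasure hi,
    integral_abs_rpow_two_thirds (hv'.mono_exponent two_thirds_le_two), avg_eq hi hv]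
  refine mul_le_mul_of_nonneg_left (Real.rpow_le_rpow ENNReal.toReal_nonneg ?_ (by norm_num))
    (π.len_pos hi).le
  exact ENNReal.toReal_mono hv'.eLpNorm_ne_top
    (eLpNorm_le_eLpNorm_of_exponent_le two_thirds_le_two hv'.1)

variable (π) in
/-- The sum `∑ h_i ⟨v⟩_i^{2/3}`, which is `α_h^{1/3}` for `v = r_h`; the discrete counterpart of
`∫ |v|^{2/3}`. -/
noncomputable def avgSum (v : ℝ → ℝ) : ℝ :=
  ∑ i ∈ Finset.range N, π.len i * π.avg v i ^ (2 / 3 : ℝ)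

theorem alpha_eq_avgSum_pow (v : ℝ → ℝ) : π.alpha v = π.avgSum v ^ 3 := rfl

theorem len_mul_avg_rpow_nonneg (v : ℝ → ℝ) (hi : i < N) :
    0 ≤ π.len i * π.avg v i ^ (2 / 3 : ℝ) :=
  mul_nonneg (π.len_pos hi).le (Real.rpow_nonneg (avg_nonneg v i) _)

theorem avgSum_nonneg (v : ℝ → ℝ) : 0 ≤ π.avgSum v :=
  Finset.sum_nonneg fun _ hi => len_mul_avg_rpow_nonneg v (Finset.mem_range.1 hi)

theorem sqrt_alpha (v : ℝ → ℝ) : √(π.alpha v) = π.avgSum v ^ (3 / 2 : ℝ) := by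
  rw [alpha_eq_avgSum_pow, Real.sqrt_eq_rpow, ← Real.rpow_natCast,
    ← Real.rpow_mul (avgSum_nonneg v)]
  norm_num

theorem avgSum_le_add (hv : MemLp v 2 muOmega) (h1 : MemLp v₁ 2 muOmega)
    (h2 : MemLp v₂ 2 muOmega) (h : ∀ᵐ x ∂muOmega, |v x| ≤ |v₁ x| + |v₂ x|) :
    π.avgSum v ≤ π.avgSum v₁ + π.avgSum v₂ := by
  rw [avgSum, avgSum, avgSum, ← Finset.sum_add_distrib]
  refine Finset.sum_le_sum fun i hi => ?_
  rw [Finset.mem_range] at hi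
  rw [← mul_add]
  refine mul_le_mul_of_nonneg_left ?_ (π.len_pos hi).le
  exact (Real.rpow_le_rpow (avg_nonneg v i) (avg_le_add hi hv h1 h2 h) (by norm_num)).trans
    (Real.rpow_add_le_add_rpow (avg_nonneg _ _) (avg_nonneg _ _) (by norm_num) (by norm_num))

theorem avgSum_const_mul {k : ℝ} (hk : 0 ≤ k) (v : ℝ → ℝ) :
    π.avgSum (fun x => k * v x) = k ^ (2 / 3 : ℝ) * π.avgSum v := by
  simp only [avgSum, avg_const_mul hk, Real.mul_rpow hk (avg_nonneg v _), Finset.mul_sum,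
    mul_left_comm]

theorem avgSum_le_sum {V : ℕ → ℝ} (hV : ∀ i < N, 0 ≤ V i)
    (h : ∀ i < N, ∀ᵐ x ∂π.cellMeasure i, |v x| ≤ V i) :
    π.avgSum v ≤ ∑ i ∈ Finset.range N, π.len i * V i ^ (2 / 3 : ℝ) := by
  refine Finset.sum_le_sum fun i hi => ?_
  rw [Finset.mem_range] at hi
  exact mul_le_mul_of_nonneg_left (Real.rpow_le_rpow (avg_nonneg v i)
    (avg_le_of_ae_abs_le hi (hV i hi) (h i hi)) (by norm_num)) (π.len_pos hi).le

theorem avgSum_const_le {k : ℝ} (hk : 0 ≤ k) : π.avgSum (fun _ => k) ≤ k ^ (2 / 3 : ℝ) := by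
  refine (avgSum_le_sum (V := fun _ => k) (fun _ _ => hk)
    fun _ _ => ae_of_all _ fun _ => (abs_of_nonneg hk).le).trans_eq ?_
  rw [← Finset.sum_mul, π.sum_len, one_mul]

theorem sum_len_mul_avg_sq (hv : MemLp v 2 muOmega) :
    ∑ i ∈ Finset.range N, π.len i * π.avg v i ^ 2 = ∫ x in Omega, v x ^ 2 := by
  rw [← π.sum_integral_cell hv.integrable_sq]
  exact Finset.sum_congr rfl fun i hi => len_mul_avg_sq (Finset.mem_range.1 hi)

theorem avgSum_le_integral_sq (hv : MemLp v 2 muOmega) :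
    π.avgSum v ≤ (∫ x in Omega, v x ^ 2) ^ (1 / 3 : ℝ) := by
  have hrpow (i : ℕ) : π.avg v i ^ (2 / 3 : ℝ) = (π.avg v i ^ 2) ^ (1 / 3 : ℝ) := by
    rw [← Real.rpow_natCast, ← Real.rpow_mul (avg_nonneg v i)]
    norm_num
  have hconcave := Real.concaveOn_rpow (p := 1 / 3) (by norm_num) (by norm_num)
  rw [avgSum, ← sum_len_mul_avg_sq (π := π) hv]
  simp only [hrpow]
  exact hconcave.le_map_sum (fun i hi => (π.len_pos (Finset.mem_range.1 hi)).le) π.sum_len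
    fun i _ => mem_Ici.2 (sq_nonneg _)

theorem integral_rpow_le_avgSum (hv : MemLp v 2 muOmega) :
    ∫ x in Omega, |v x| ^ (2 / 3 : ℝ) ≤ π.avgSum v := by
  rw [← π.sum_integral_cell (integrable_abs_rpow_two_thirds hv)]
  exact Finset.sum_le_sum fun i hi => integral_cell_rpow_le (Finset.mem_range.1 hi) hv

end Mesh

/-! ### Galerkin orthogonality and the error estimate -/

/-- `v ∈ H¹₀(Ω)` with derivative `w`, in the form `v = ∫₀ˣ w` with vanishing boundary values. -/
structure HasH10Deriv (v w : ℝ → ℝ) : Prop where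
  memLp : MemLp w 2 muOmega
  prim_one : prim w 1 = 0
  ae_eq_prim : ∀ᵐ x ∂muOmega, v x = prim w x

namespace HasH10Deriv

variable {v v₁ v₂ w w₁ w₂ : ℝ → ℝ}

theorem integrable (h : HasH10Deriv v w) : Integrable w muOmega := h.memLp.integrable one_le_two

theorem weakDeriv_ae_eq (h : HasH10Deriv v w) : weakDeriv v =ᵐ[muOmega] w :=
  (hasWeakDeriv_of_ae_eq_prim (k := 0) h.integrable
    (by simpa only [zero_add] using h.ae_eq_prim)).weakDeriv_ae_eq

theorem sub (h₁ : HasH10Deriv v₁ w₁) (h₂ : HasH10Deriv v₂ w₂) :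
    HasH10Deriv (v₁ - v₂) (fun x => w₁ x - w₂ x) where
  memLp := h₁.memLp.sub h₂.memLp
  prim_one := by
    rw [prim_sub h₁.integrable h₂.integrable one_mem_unitInterval, h₁.prim_one, h₂.prim_one,
      sub_zero]
  ae_eq_prim := by
    filter_upwards [h₁.ae_eq_prim, h₂.ae_eq_prim, ae_mem_Omega] with x hx₁ hx₂ hx
    rw [prim_sub h₁.integrable h₂.integrable (Omega_subset_Icc hx), Pi.sub_apply, hx₁, hx₂]

end HasH10Deriv

theorem MemH10.hasH10Deriv {v : ℝ → ℝ} (h : MemH10 v) : HasH10Deriv v (weakDeriv v) :=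
  ⟨h.memLp_weakDeriv, h.prim_weakDeriv_one, h.ae_eq_prim⟩

theorem IsTestFunction.hasH10Deriv {φ : ℝ → ℝ} (h : IsTestFunction φ) :
    HasH10Deriv φ (_root_.deriv φ) where
  memLp := h.deriv.memLp_top.mono_exponent le_top
  prim_one := by rw [h.prim_deriv, h.eq_zero_of_notMem (by simp [Omega])]
  ae_eq_prim := ae_of_all _ fun x => (h.prim_deriv x).symm

theorem Mesh.IsSlope.hasH10Deriv {N : ℕ} {π : Mesh N} {v s : ℝ → ℝ} (h : π.IsSlope v s) :
    HasH10Deriv v s where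
  memLp := h.memLp.mono_exponent le_top
  prim_one := h.prim_one
  ae_eq_prim := ae_mem_Omega.mono fun x hx => h.eq_prim x (Omega_subset_Icc hx)

/-- A primitive of the residual functional `v ↦ (f, v) - B(u, v)`, for `w = u'`: the functional
takes the value `∫ P v'` at `v`. -/
noncomputable def residualPotential (a b c f w : ℝ → ℝ) : ℝ → ℝ := fun x =>
  -(a x * w x) - prim (fun t => f t - lowerOrder b c w t) x

namespace Coefficients

variable {a₀ : ℝ} {a b c f u v w t : ℝ → ℝ}

theorem memLp_lowerOrder (hc : Coefficients a₀ a b c) (hw : MemLp w 2 muOmega) :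
    MemLp (lowerOrder b c w) 2 muOmega := by
  have hprim := memLp_top_prim (hw.integrable one_le_two)
  have hcw : MemLp (fun x => c x * prim w x) ∞ muOmega := hprim.mul hc.c_mem
  have hbw : MemLp (fun x => b x * w x) 2 muOmega := hw.mul hc.b_mem.1
  exact hbw.add (hcw.mono_exponent le_top)

theorem integrable_sub_lowerOrder (hc : Coefficients a₀ a b c) (hf : MemLp f 2 muOmega)
    (hw : MemLp w 2 muOmega) : Integrable (fun x => f x - lowerOrder b c w x) muOmega :=
  (hf.sub (hc.memLp_lowerOrder hw)).integrable one_le_two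

theorem memLp_residualPotential (hc : Coefficients a₀ a b c) (hf : MemLp f 2 muOmega)
    (hw : MemLp w 2 muOmega) : MemLp (residualPotential a b c f w) 2 muOmega := by
  have haw : MemLp (fun x => a x * w x) 2 muOmega := hw.mul hc.a_mem.1
  exact haw.neg.sub ((memLp_top_prim (hc.integrable_sub_lowerOrder hf hw)).mono_exponent le_top)

theorem pairing_sub_bilin (hc : Coefficients a₀ a b c) (hf : MemLp f 2 muOmega)
    (hu : HasH10Deriv u w) (hv : HasH10Deriv v t) :
    pairing f v - bilin a b c u v = ∫ x in Omega, residualPotential a b c f w x * t x := by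
  have hg := hc.integrable_sub_lowerOrder hf hu.memLp
  have htop := memLp_top_prim hv.integrable
  have haw : MemLp (fun x => a x * w x) 2 muOmega := hu.memLp.mul hc.a_mem.1
  have hflux : Integrable (fun x => a x * w x * t x) muOmega := haw.integrable_mul hv.memLp
  have hflux' : Integrable (fun x => -(a x * w x * t x)) muOmega := hflux.neg
  have hlow : Integrable (fun x => lowerOrder b c w x * prim t x) muOmega :=
    (hc.integrable_lowerOrder hu.integrable).mul_of_top_left htop
  have hfv : Integrable (fun x => f x * prim t x) muOmega :=
    (hf.integrable one_le_two).mul_of_top_left htop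
  have hgt : Integrable (fun x => prim (fun y => f y - lowerOrder b c w y) x * t x) muOmega :=
    hv.integrable.mul_of_top_right (memLp_top_prim hg)
  have hpairing : pairing f v = ∫ x in Omega, f x * prim t x :=
    integral_congr_ae (hv.ae_eq_prim.mono fun x hx => by simp only [hx])
  have hbilin : bilin a b c u v
      = (∫ x in Omega, a x * w x * t x) + ∫ x in Omega, lowerOrder b c w x * prim t x := by
    rw [bilin, ← integral_add hflux hlow]
    refine integral_congr_ae ?_
    filter_upwards [hu.ae_eq_prim, hv.ae_eq_prim, hu.weakDeriv_ae_eq, hv.weakDeriv_ae_eq]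
      with x hux hvx hux' hvx'
    simp only [hux, hvx, hux', hvx', lowerOrder]
    ring
  have hparts := integral_prim_mul hg hv.integrable 0 0
  simp only [hv.prim_one, zero_add, mul_zero, sub_zero, zero_sub, sub_mul] at hparts
  rw [integral_sub hfv hlow] at hparts
  simp only [residualPotential, sub_mul, neg_mul]
  rw [integral_sub hflux' hgt, integral_neg, hparts, hpairing, hbilin]
  ring

theorem isIntegratedSolution_residualPotential (hc : Coefficients a₀ a b c)
    (hf : MemLp f 2 muOmega) (hu : HasH10Deriv u w) :
    IsIntegratedSolution a b c (fun x => -residualPotential a b c f w x - prim f x) w where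
  memLp := hu.memLp
  prim_one := hu.prim_one
  ae_eq := by
    refine ⟨0, ae_mem_Omega.mono fun x hx => ?_⟩
    rw [residualPotential, prim_sub (hf.integrable one_le_two)
      (hc.integrable_lowerOrder hu.integrable) (Omega_subset_Icc hx)]
    ring

end Coefficients

theorem IsIntegratedSolution.of_ae_eq_const_add {a b c R S w : ℝ → ℝ} {k : ℝ}
    (h : IsIntegratedSolution a b c R w) (hRS : ∀ᵐ x ∂muOmega, R x = k + S x) :
    IsIntegratedSolution a b c S w where
  memLp := h.memLp
  prim_one := h.prim_one
  ae_eq := by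
    obtain ⟨l, hl⟩ := h.ae_eq
    refine ⟨l + k, ?_⟩
    filter_upwards [hl, hRS] with x hx hx'
    rw [hx, hx']
    ring

theorem IsWeakSolution.exists_residualPotential_ae_eq {a₀ : ℝ} {a b c f u : ℝ → ℝ}
    (hu : IsWeakSolution a b c f u) (hc : Coefficients a₀ a b c) (hf : MemLp f 2 muOmega) :
    ∃ k, ∀ᵐ x ∂muOmega, residualPotential a b c f (weakDeriv u) x = k := by
  refine ae_eq_const_of_integral_mul_deriv_eq_zero (IntegrableOn.locallyIntegrableOn
    ((hc.memLp_residualPotential hf hu.1.memLp_weakDeriv).integrable one_le_two)) fun φ hφ => ?_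
  rw [← hc.pairing_sub_bilin hf hu.1.hasH10Deriv hφ.hasH10Deriv, hu.2 φ hφ.memH10, sub_self]

section Residual

variable {a₀ : ℝ} {a b c f v w : ℝ → ℝ}

theorem HasH10Deriv.pdeResidual_ae_eq (h : HasH10Deriv v w) :
    pdeResidual a b c f v =ᵐ[muOmega] fun x => f x + weakDeriv a x * w x - lowerOrder b c w x := by
  filter_upwards [h.weakDeriv_ae_eq, h.ae_eq_prim] with x hx hx'
  rw [pdeResidual, lowerOrder, hx, hx']
  ring

theorem HasH10Deriv.memLp_pdeResidual (h : HasH10Deriv v w) (hc : Coefficients a₀ a b c)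
    (hf : MemLp f 2 muOmega) : MemLp (pdeResidual a b c f v) 2 muOmega := by
  have haw : MemLp (fun x => weakDeriv a x * w x) 2 muOmega :=
    h.memLp.mul hc.a_mem.memLp_weakDeriv
  exact (memLp_congr_ae h.pdeResidual_ae_eq).2 ((hf.add haw).sub (hc.memLp_lowerOrder h.memLp))

theorem Coefficients.exists_abs_pdeResidual_sub_le (hc : Coefficients a₀ a b c) :
    ∃ M, 0 ≤ M ∧ ∀ f v₁ v₂ w₁ w₂ : ℝ → ℝ, HasH10Deriv v₁ w₁ → HasH10Deriv v₂ w₂ →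
      ∀ᵐ x ∂muOmega, |pdeResidual a b c f v₁ x - pdeResidual a b c f v₂ x|
        ≤ M * (|w₁ x - w₂ x| + |prim (fun t => w₁ t - w₂ t) x|) := by
  have hdrift : MemLp (fun x => weakDeriv a x - b x) ∞ muOmega :=
    hc.a_mem.memLp_weakDeriv.sub hc.b_mem.1
  obtain ⟨L, hL0, hL⟩ := exists_ae_abs_le_of_memLp_top hdrift
  obtain ⟨M, hM0, hM⟩ := exists_ae_abs_le_of_memLp_top hc.c_mem
  refine ⟨L + M, add_nonneg hL0 hM0, fun f v₁ v₂ w₁ w₂ h₁ h₂ => ?_⟩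
  filter_upwards [hL, hM, h₁.pdeResidual_ae_eq (a := a) (b := b) (c := c) (f := f),
    h₂.pdeResidual_ae_eq (a := a) (b := b) (c := c) (f := f), ae_mem_Omega]
    with x hLx hMx hx₁ hx₂ hx
  rw [hx₁, hx₂]
  calc _ = |(weakDeriv a x - b x) * (w₁ x - w₂ x) - c x * prim (fun t => w₁ t - w₂ t) x| := by
        rw [prim_sub h₁.integrable h₂.integrable (Omega_subset_Icc hx)]
        simp only [lowerOrder]
        ring_nf
    _ ≤ L * |w₁ x - w₂ x| + M * |prim (fun t => w₁ t - w₂ t) x| := by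
        refine (abs_sub _ _).trans ?_
        rw [abs_mul, abs_mul]
        gcongr
    _ ≤ (L + M) * (|w₁ x - w₂ x| + |prim (fun t => w₁ t - w₂ t) x|) := by
        have h₁ : 0 ≤ M * |w₁ x - w₂ x| := by positivity
        have h₂ : 0 ≤ L * |prim (fun t => w₁ t - w₂ t) x| := by positivity
        linarith

end Residual

namespace Mesh

variable {N : ℕ} {π : Mesh N}

theorem integral_mul_hatSlope {T : ℝ → ℝ} (hT : Integrable T muOmega) {i : ℕ} (hi : i + 1 < N) :
    ∫ x in Omega, T x * π.hatSlope (i + 1) x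
      = (∫ x, T x ∂π.cellMeasure i) - ∫ x, T x ∂π.cellMeasure (i + 1) := by
  have hmul (j : ℕ) : (fun x => T x * (π.cell j).indicator (fun _ => 1 / π.len j) x)
      = (π.cell j).indicator fun x => 1 / π.len j * T x := by
    ext x
    by_cases hx : x ∈ π.cell j
    · simp only [indicator_of_mem hx, mul_comm]
    · simp only [indicator_of_notMem hx, mul_zero]
  have hint (j : ℕ) : Integrable (fun x => T x * (π.cell j).indicator (fun _ => 1 / π.len j) x)
      muOmega := by
    rw [hmul j]
    exact (hT.const_mul _).indicator (π.measurableSet_cell j)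
  have hcell {j : ℕ} (hj : j < N) :
      ∫ x in Omega, T x * (π.cell j).indicator (fun _ => 1 / π.len j) x
        = ∫ x, T x ∂π.cellMeasure j := by
    rw [hmul j, setIntegral_indicator (π.measurableSet_cell j), inter_eq_right.2 (π.cell_subset hj),
      integral_const_mul, integral_cellMeasure hj]
  simp only [hatSlope, Nat.add_sub_cancel, mul_sub]
  rw [integral_sub (hint i) (hint (i + 1)), hcell ((Nat.lt_succ_self i).trans hi), hcell hi]

variable {a₀ : ℝ} {a b c f uh s : ℝ → ℝ}

theorem IsFESolution.exists_integral_residualPotential_eq (h : π.IsFESolution a b c f uh)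
    (hs : π.IsSlope uh s) (hc : Coefficients a₀ a b c) (hf : MemLp f 2 muOmega) :
    ∃ K, ∀ i < N, ∫ x, residualPotential a b c f s x ∂π.cellMeasure i = K := by
  have hP := (hc.memLp_residualPotential hf hs.hasH10Deriv.memLp).integrable one_le_two
  refine ⟨∫ x, residualPotential a b c f s x ∂π.cellMeasure 0, fun i => ?_⟩
  induction i with
  | zero => exact fun _ => rfl
  | succ j ih =>
    intro hj
    have hmem : j + 1 ∈ Ioo 0 N := ⟨j.succ_pos, hj⟩
    have horth := hc.pairing_sub_bilin hf hs.hasH10Deriv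
      (isSlope_hatSlope (π := π) hmem).hasH10Deriv
    rw [h.2 _ (Submodule.subset_span ⟨j + 1, hmem, rfl⟩), sub_self,
      integral_mul_hatSlope hP hj] at horth
    rw [← ih ((Nat.lt_succ_self j).trans hj)]
    linarith

theorem IsSlope.ae_abs_residualPotential_sub_integral_le (hs : π.IsSlope uh s)
    (hc : Coefficients a₀ a b c) (hf : MemLp f 2 muOmega) {i : ℕ} (hi : i < N) :
    ∀ᵐ x ∂π.cellMeasure i, |residualPotential a b c f s x
        - ∫ y, residualPotential a b c f s y ∂π.cellMeasure i|
      ≤ ∫ x in π.cell i, |pdeResidual a b c f uh x| := by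
  obtain ⟨σ, hσ⟩ := hs.const_on_cell i hi
  have ha' : Integrable (weakDeriv a) muOmega := hc.a_mem.memLp_weakDeriv.integrable le_top
  obtain ⟨k, hk⟩ := hc.a_mem.hasWeakDeriv.exists_ae_eq_prim ha'
  have hg := hc.integrable_sub_lowerOrder hf hs.hasH10Deriv.memLp
  set g : ℝ → ℝ := fun x => -σ * weakDeriv a x - (f x - lowerOrder b c s x) with hg_def
  have hT : ∀ᵐ x ∂π.cellMeasure i,
      residualPotential a b c f s x = -(σ * k) + prim g x := by
    filter_upwards [ae_cellMeasure hi hk, ae_mem_cell i] with x hx hxc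
    rw [hg_def, prim_sub (ha'.const_mul _) hg (Omega_subset_Icc (π.cell_subset hi hxc)),
      prim_const_mul, residualPotential, hx, hσ x hxc]
    ring
  have hres : ∫ x in π.cell i, |g x| = ∫ x in π.cell i, |pdeResidual a b c f uh x| := by
    refine integral_congr_ae ?_
    filter_upwards [ae_restrict_of_ae_restrict_of_subset (π.cell_subset hi)
      hs.hasH10Deriv.pdeResidual_ae_eq, ae_restrict_mem (π.measurableSet_cell i)] with x hx hxc
    rw [hx, hσ x hxc, ← abs_neg]
    simp only [hg_def]
    ring_nf
  have hgi : Integrable g muOmega := (ha'.const_mul _).sub hg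
  rw [← hres]
  exact ae_abs_sub_integral_cellMeasure_le hgi hi hT

end Mesh

theorem Coefficients.exists_error_estimate {a₀ : ℝ} {a b c : ℝ → ℝ}
    (hc : Coefficients a₀ a b c) : ∃ C, 1 ≤ C ∧ ∀ f u : ℝ → ℝ, MemLp f 2 muOmega →
      IsWeakSolution a b c f u → ∀ (N : ℕ) (π : Mesh N) (uh : ℝ → ℝ), π.IsFESolution a b c f uh →
      ∃ R, MemLp R 2 muOmega ∧
        (∀ i < N, ∀ᵐ x ∂π.cellMeasure i,
          |R x| ≤ ∫ t in π.cell i, |pdeResidual a b c f uh t|) ∧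
        ∫ x in Omega, weakDeriv (u - uh) x ^ 2 ≤ C ^ 2 * ∫ x in Omega, R x ^ 2 ∧
        ∀ᵐ x ∂muOmega, |pdeResidual a b c f u x - pdeResidual a b c f uh x|
          ≤ C * (|R x| + ∫ t in Omega, |R t|) := by
  obtain ⟨A, hA0, hA⟩ := hc.exists_pointwise_stability
  obtain ⟨M, hM0, hM⟩ := hc.exists_abs_pdeResidual_sub_le
  have ha₀ := hc.pos
  refine ⟨1 + a₀⁻¹ + M * A, by rw [add_assoc]; exact le_add_of_nonneg_right (by positivity),
    fun f u hf hu N π uh h => ?_⟩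
  obtain ⟨s, hs⟩ := Mesh.exists_isSlope h.1
  obtain ⟨K, hK⟩ := h.exists_integral_residualPotential_eq hs hc hf
  obtain ⟨k, hk⟩ := hu.exists_residualPotential_ae_eq hc hf
  have hu' := hu.1.hasH10Deriv
  have hs' := hs.hasH10Deriv
  set R : ℝ → ℝ := fun x => residualPotential a b c f s x - K
  have hR : MemLp R 2 muOmega := (hc.memLp_residualPotential hf hs'.memLp).sub (memLp_const K)
  have herror : IsIntegratedSolution a b c R (fun x => weakDeriv u x - s x) :=
    (hc.sub_isIntegratedSolution (hc.isIntegratedSolution_residualPotential hf hu')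
      (hc.isIntegratedSolution_residualPotential hf hs')).of_ae_eq_const_add (k := K - k)
      (hk.mono fun x hx => by simp only [hx, R]; ring)
  refine ⟨R, hR, fun i hi => ?_, ?_, ?_⟩
  · simpa only [hK i hi] using hs.ae_abs_residualPotential_sub_integral_le hc hf hi
  · have henergy := hc.sq_mul_integral_sq_le hR herror
    calc ∫ x in Omega, weakDeriv (u - uh) x ^ 2 = ∫ x in Omega, (weakDeriv u x - s x) ^ 2 :=
          integral_congr_ae ((hu'.sub hs').weakDeriv_ae_eq.fun_comp (· ^ 2))
      _ ≤ a₀⁻¹ ^ 2 * ∫ x in Omega, R x ^ 2 := by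
          rwa [inv_pow, ← div_eq_inv_mul, le_div_iff₀' (by positivity)]
      _ ≤ _ := by
          gcongr
          linarith [mul_nonneg hM0 hA0]
  · filter_upwards [hM f u uh _ _ hu' hs', hA R _ hR herror] with x hx hx'
    calc _ ≤ M * (A * (|R x| + ∫ t in Omega, |R t|)) :=
          hx.trans (mul_le_mul_of_nonneg_left hx' hM0)
      _ = M * A * (|R x| + ∫ t in Omega, |R t|) := (mul_assoc _ _ _).symm
      _ ≤ _ := by
          gcongr
          exact le_add_of_nonneg_left (by positivity)

/-! ### Quasi-equidistributing meshes -/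

theorem rpow_two_thirds_pow_three {t : ℝ} (ht : 0 ≤ t) : (t ^ (2 / 3 : ℝ)) ^ 3 = t ^ 2 := by
  rw [← Real.rpow_natCast, ← Real.rpow_mul ht]
  norm_num

namespace Mesh

variable {N : ℕ} {π : Mesh N} {i : ℕ} {v R : ℝ → ℝ} {κ : ℝ}

theorem alpha_nonneg (v : ℝ → ℝ) : 0 ≤ π.alpha v := pow_nonneg (avgSum_nonneg v) 3

theorem inv_alpha_mul_avg_sq_nonneg (v : ℝ → ℝ) (i : ℕ) :
    0 ≤ 1 / π.alpha v * π.avg v i ^ 2 :=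
  mul_nonneg (one_div_nonneg.2 (alpha_nonneg v)) (sq_nonneg _)

theorem inv_alpha_mul_avg_sq_rpow (v : ℝ → ℝ) (i : ℕ) :
    (1 / π.alpha v * π.avg v i ^ 2) ^ (1 / 3 : ℝ) = (π.avgSum v)⁻¹ * π.avg v i ^ (2 / 3 : ℝ) := by
  have hS := avgSum_nonneg (π := π) v
  rw [alpha_eq_avgSum_pow, one_div, ← inv_pow, Real.mul_rpow (by positivity) (by positivity),
    ← Real.rpow_natCast, ← Real.rpow_natCast, ← Real.rpow_mul (by positivity),
    ← Real.rpow_mul (avg_nonneg v i)]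
  norm_num

theorem one_le_rho (v : ℝ → ℝ) (i : ℕ) : 1 ≤ π.rho v i :=
  Real.one_le_rpow (le_add_of_nonneg_right (inv_alpha_mul_avg_sq_nonneg v i)) (by norm_num)

theorem inv_avgSum_mul_le_rho (v : ℝ → ℝ) (i : ℕ) :
    (π.avgSum v)⁻¹ * π.avg v i ^ (2 / 3 : ℝ) ≤ π.rho v i := by
  rw [← inv_alpha_mul_avg_sq_rpow]
  exact Real.rpow_le_rpow (inv_alpha_mul_avg_sq_nonneg v i)
    (le_add_of_nonneg_left zero_le_one) (by norm_num)

theorem rho_le (v : ℝ → ℝ) (i : ℕ) :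
    π.rho v i ≤ 1 + (π.avgSum v)⁻¹ * π.avg v i ^ (2 / 3 : ℝ) := by
  rw [← inv_alpha_mul_avg_sq_rpow]
  simpa only [rho, Real.one_rpow] using Real.rpow_add_le_add_rpow zero_le_one
    (inv_alpha_mul_avg_sq_nonneg v i) (by norm_num : (0 : ℝ) ≤ 1 / 3) (by norm_num)

theorem sigma_pos (v : ℝ → ℝ) : 0 < π.sigma v :=
  Finset.sum_pos (fun i hi => mul_pos (zero_lt_one.trans_le (one_le_rho v i))
    (π.len_pos (Finset.mem_range.1 hi))) (Finset.nonempty_range_iff.2 π.pos.ne')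

theorem sigma_le_two (v : ℝ → ℝ) : π.sigma v ≤ 2 := by
  calc π.sigma v ≤ ∑ i ∈ Finset.range N,
          (π.len i + (π.avgSum v)⁻¹ * (π.len i * π.avg v i ^ (2 / 3 : ℝ))) :=
        Finset.sum_le_sum fun i hi => by
          linarith [mul_le_mul_of_nonneg_right (rho_le (π := π) v i)
            (π.len_pos (Finset.mem_range.1 hi)).le]
    _ = 1 + (π.avgSum v)⁻¹ * π.avgSum v := by
        rw [Finset.sum_add_distrib, π.sum_len, ← Finset.mul_sum, avgSum]
    _ ≤ 2 := by linarith [inv_mul_le_one (a := π.avgSum v)]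

theorem avg_le_len_mul_avg (hi : i < N) (hv : MemLp v 2 muOmega)
    (hRv : ∀ᵐ x ∂π.cellMeasure i, |R x| ≤ ∫ t in π.cell i, |v t|) :
    π.avg R i ≤ π.len i * π.avg v i :=
  avg_le_of_ae_abs_le hi (mul_nonneg (π.len_pos hi).le (avg_nonneg v i))
    (hRv.mono fun _ hx => hx.trans (integral_cell_abs_le hi hv))

namespace IsQuasiEquidistributing

theorem rho_mul_len_le_sigma (h : π.IsQuasiEquidistributing v κ) (hi : i < N) :
    π.rho v i * π.len i ≤ κ / N * π.sigma v := by
  have hN : (0 : ℝ) < N := Nat.cast_pos.2 π.pos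
  rw [div_mul_eq_mul_div, le_div_iff₀' hN, ← mul_assoc]
  exact (div_le_iff₀ (sigma_pos v)).1 (h i hi)

theorem one_le (h : π.IsQuasiEquidistributing v κ) : 1 ≤ κ := by
  have hN : (N : ℝ) ≠ 0 := Nat.cast_ne_zero.2 π.pos.ne'
  have hsum : π.sigma v ≤ ∑ _i ∈ Finset.range N, κ / N * π.sigma v :=
    Finset.sum_le_sum fun i hi => h.rho_mul_len_le_sigma (Finset.mem_range.1 hi)
  rw [Finset.sum_const, Finset.card_range, nsmul_eq_mul, ← mul_assoc, mul_div_cancel₀ κ hN]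
    at hsum
  exact (le_mul_iff_one_le_left (sigma_pos v)).1 hsum

theorem rho_mul_len_le (h : π.IsQuasiEquidistributing v κ) (hi : i < N) :
    π.rho v i * π.len i ≤ 2 * κ / N := by
  have hκ := h.one_le
  calc π.rho v i * π.len i ≤ κ / N * π.sigma v := h.rho_mul_len_le_sigma hi
    _ ≤ κ / N * 2 := by
        gcongr
        exact sigma_le_two v
    _ = 2 * κ / N := by ring

theorem len_le (h : π.IsQuasiEquidistributing v κ) (hi : i < N) : π.len i ≤ 2 * κ / N :=
  (le_mul_of_one_le_left (π.len_pos hi).le (one_le_rho v i)).trans (h.rho_mul_len_le hi)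

theorem len_mul_avg_rpow_le (h : π.IsQuasiEquidistributing v κ) (hi : i < N) :
    π.len i * π.avg v i ^ (2 / 3 : ℝ) ≤ 2 * κ / N * π.avgSum v := by
  rcases (avgSum_nonneg (π := π) v).eq_or_lt with hS | hS
  · rw [← hS, mul_zero, hS]
    exact Finset.single_le_sum (f := fun i => π.len i * π.avg v i ^ (2 / 3 : ℝ))
      (fun j hj => len_mul_avg_rpow_nonneg v (Finset.mem_range.1 hj)) (Finset.mem_range.2 hi)
  · have hrho := (mul_le_mul_of_nonneg_right (inv_avgSum_mul_le_rho (π := π) v i)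
      (π.len_pos hi).le).trans (h.rho_mul_len_le hi)
    rw [mul_assoc, inv_mul_le_iff₀ hS] at hrho
    linarith

theorem len_mul_len_mul_avg_sq_le (h : π.IsQuasiEquidistributing v κ) (hi : i < N) :
    π.len i * (π.len i * π.avg v i) ^ 2
      ≤ (2 * κ / N * π.avgSum v) ^ 2 * (π.len i * π.avg v i ^ (2 / 3 : ℝ)) := by
  have hle := h.len_mul_avg_rpow_le hi
  have hnonneg := len_mul_avg_rpow_nonneg (π := π) v hi
  calc π.len i * (π.len i * π.avg v i) ^ 2
      = (π.len i * π.avg v i ^ (2 / 3 : ℝ)) ^ 2 * (π.len i * π.avg v i ^ (2 / 3 : ℝ)) := by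
        rw [mul_pow, ← rpow_two_thirds_pow_three (avg_nonneg v i)]
        ring
    _ ≤ _ := by gcongr

theorem integral_sq_le (h : π.IsQuasiEquidistributing v κ) (hv : MemLp v 2 muOmega)
    (hR : MemLp R 2 muOmega)
    (hRv : ∀ i < N, ∀ᵐ x ∂π.cellMeasure i, |R x| ≤ ∫ t in π.cell i, |v t|) :
    ∫ x in Omega, R x ^ 2 ≤ (2 * κ / N) ^ 2 * π.alpha v := by
  calc ∫ x in Omega, R x ^ 2 = ∑ i ∈ Finset.range N, π.len i * π.avg R i ^ 2 :=
        (sum_len_mul_avg_sq hR).symm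
    _ ≤ ∑ i ∈ Finset.range N,
          (2 * κ / N * π.avgSum v) ^ 2 * (π.len i * π.avg v i ^ (2 / 3 : ℝ)) := by
        refine Finset.sum_le_sum fun i hi => ?_
        rw [Finset.mem_range] at hi
        have hlen := (π.len_pos hi).le
        refine le_trans ?_ (h.len_mul_len_mul_avg_sq_le hi)
        exact mul_le_mul_of_nonneg_left (pow_le_pow_left₀ (avg_nonneg R i)
          (avg_le_len_mul_avg hi hv (hRv i hi)) 2) hlen
    _ = (2 * κ / N) ^ 2 * π.alpha v := by
        rw [← Finset.mul_sum, ← avgSum, alpha_eq_avgSum_pow]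
        ring

theorem integral_abs_le (h : π.IsQuasiEquidistributing v κ) (hv : MemLp v 2 muOmega)
    (hR : MemLp R 2 muOmega)
    (hRv : ∀ i < N, ∀ᵐ x ∂π.cellMeasure i, |R x| ≤ ∫ t in π.cell i, |v t|) :
    ∫ x in Omega, |R x| ≤ 2 * κ / N * √(π.alpha v) := by
  have hκ := h.one_le
  refine le_of_sq_le_sq ((sq_integral_abs_le hR).trans ?_) (by positivity)
  rw [mul_pow, Real.sq_sqrt (alpha_nonneg v)]
  exact h.integral_sq_le hv hR hRv

theorem avgSum_le (h : π.IsQuasiEquidistributing v κ) (hv : MemLp v 2 muOmega)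
    (hRv : ∀ i < N, ∀ᵐ x ∂π.cellMeasure i, |R x| ≤ ∫ t in π.cell i, |v t|) :
    π.avgSum R ≤ (2 * κ / N) ^ (2 / 3 : ℝ) * π.avgSum v := by
  rw [avgSum, avgSum, Finset.mul_sum]
  refine Finset.sum_le_sum fun i hi => ?_
  rw [Finset.mem_range] at hi
  have hlen := (π.len_pos hi).le
  calc π.len i * π.avg R i ^ (2 / 3 : ℝ)
      ≤ π.len i * (2 * κ / N * π.avg v i) ^ (2 / 3 : ℝ) := by
        gcongr
        · exact avg_nonneg R i
        · exact (avg_le_len_mul_avg hi hv (hRv i hi)).trans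
            (mul_le_mul_of_nonneg_right (h.len_le hi) (avg_nonneg v i))
    _ = (2 * κ / N) ^ (2 / 3 : ℝ) * (π.len i * π.avg v i ^ (2 / 3 : ℝ)) := by
        rw [Real.mul_rpow (hlen.trans (h.len_le hi)) (avg_nonneg v i), mul_left_comm]

theorem avgSum_integral_abs_le (h : π.IsQuasiEquidistributing v κ) (hv : MemLp v 2 muOmega)
    (hR : MemLp R 2 muOmega)
    (hRv : ∀ i < N, ∀ᵐ x ∂π.cellMeasure i, |R x| ≤ ∫ t in π.cell i, |v t|) :
    π.avgSum (fun _ => ∫ t in Omega, |R t|) ≤ (2 * κ / N) ^ (2 / 3 : ℝ) * π.avgSum v := by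
  have hκ := h.one_le
  have hJ : 0 ≤ ∫ t in Omega, |R t| := integral_nonneg fun _ => abs_nonneg _
  have hS := avgSum_nonneg (π := π) v
  calc π.avgSum (fun _ => ∫ t in Omega, |R t|) ≤ (∫ t in Omega, |R t|) ^ (2 / 3 : ℝ) :=
        avgSum_const_le hJ
    _ ≤ (2 * κ / N * √(π.alpha v)) ^ (2 / 3 : ℝ) :=
        Real.rpow_le_rpow hJ (h.integral_abs_le hv hR hRv) (by norm_num)
    _ = (2 * κ / N) ^ (2 / 3 : ℝ) * π.avgSum v := by
        rw [sqrt_alpha, Real.mul_rpow (by positivity) (by positivity), ← Real.rpow_mul hS]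
        norm_num

theorem avgSum_sub_le {r : ℝ → ℝ} {C : ℝ} (h : π.IsQuasiEquidistributing v κ) (hC : 0 ≤ C)
    (hr : MemLp r 2 muOmega) (hv : MemLp v 2 muOmega) (hR : MemLp R 2 muOmega)
    (hRv : ∀ i < N, ∀ᵐ x ∂π.cellMeasure i, |R x| ≤ ∫ t in π.cell i, |v t|)
    (hrv : ∀ᵐ x ∂muOmega, |r x - v x| ≤ C * (|R x| + ∫ t in Omega, |R t|)) :
    π.avgSum (fun x => r x - v x) ≤ (κ * (6 * C) / N) ^ (2 / 3 : ℝ) * π.avgSum v := by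
  have hκ := h.one_le
  have hS := avgSum_nonneg (π := π) v
  set J := ∫ t in Omega, |R t|
  have hJ : 0 ≤ J := integral_nonneg fun _ => abs_nonneg _
  -- `2 ≤ 3 ^ (2 / 3)` absorbs the number of summands into the constant.
  have htwo : (2 : ℝ) ≤ 3 ^ (2 / 3 : ℝ) := by
    refine le_of_pow_le_pow_left₀ three_ne_zero (by positivity) ?_
    rw [rpow_two_thirds_pow_three zero_le_three]
    norm_num
  calc π.avgSum (fun x => r x - v x)
      ≤ π.avgSum (fun x => C * R x) + π.avgSum (fun _ => C * J) := by
        refine avgSum_le_add (hr.sub hv) (hR.const_mul C) (memLp_const _) ?_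
        filter_upwards [hrv] with x hx
        rwa [abs_mul, abs_mul, abs_of_nonneg hC, abs_of_nonneg hJ, ← mul_add]
    _ = C ^ (2 / 3 : ℝ) * (π.avgSum R + π.avgSum (fun _ => J)) := by
        rw [avgSum_const_mul hC, avgSum_const_mul hC, mul_add]
    _ ≤ C ^ (2 / 3 : ℝ) * (2 * ((2 * κ / N) ^ (2 / 3 : ℝ) * π.avgSum v)) := by
        rw [two_mul]
        gcongr
        exacts [h.avgSum_le hv hRv, h.avgSum_integral_abs_le hv hR hRv]
    _ ≤ C ^ (2 / 3 : ℝ) * (3 ^ (2 / 3 : ℝ) * ((2 * κ / N) ^ (2 / 3 : ℝ) * π.avgSum v)) := by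
        gcongr
    _ = (κ * (6 * C) / N) ^ (2 / 3 : ℝ) * π.avgSum v := by
        rw [← mul_assoc, ← mul_assoc, ← Real.mul_rpow hC (by norm_num),
          ← Real.mul_rpow (by positivity) (by positivity)]
        ring_nf

end IsQuasiEquidistributing

end Mesh

/-! ### Convergence of the intensity parameter -/

theorem normLp_two {v : ℝ → ℝ} (hv : MemLp v 2 muOmega) :
    normLp 2 v = √(∫ x in Omega, v x ^ 2) := by
  rw [normLp, toReal_eLpNorm_eq_integral_rpow (by simp) (by simp) hv, Real.sqrt_eq_rpow]
  simp

theorem normLp_one {v : ℝ → ℝ} (hv : MemLp v 1 muOmega) :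
    normLp 1 v = ∫ x in Omega, |v x| := by
  rw [normLp, toReal_eLpNorm_eq_integral_rpow (by simp) (by simp) hv]
  simp

theorem normLp_two_thirds_rpow {v : ℝ → ℝ} (hv : MemLp v 2 muOmega) :
    normLp (2 / 3) v ^ (2 / 3 : ℝ) = ∫ x in Omega, |v x| ^ (2 / 3 : ℝ) :=
  (integral_abs_rpow_two_thirds (hv.mono_exponent two_thirds_le_two)).symm

theorem normLp_two_thirds {v : ℝ → ℝ} (hv : MemLp v 2 muOmega) :
    normLp (2 / 3) v = (∫ x in Omega, |v x| ^ (2 / 3 : ℝ)) ^ (3 / 2 : ℝ) := by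
  have hnonneg : 0 ≤ normLp (2 / 3) v := ENNReal.toReal_nonneg
  rw [← normLp_two_thirds_rpow hv, ← Real.rpow_mul hnonneg]
  norm_num

theorem rpow_neg_mul_rpow {p x : ℝ} (hp : 0 ≤ p) (hx : 0 ≤ x) (s : ℝ) :
    p ^ (-s) * x ^ s = (p⁻¹ * x) ^ s := by
  rw [Real.mul_rpow (inv_nonneg.2 hp) hx, Real.inv_rpow hp, Real.rpow_neg hp]

theorem integral_abs_rpow_two_thirds_le_add {Ω : Type*} [MeasurableSpace Ω] {μ : Measure Ω}
    [IsFiniteMeasure μ] {v v₁ v₂ : Ω → ℝ} (h1 : MemLp v₁ 2 μ) (h2 : MemLp v₂ 2 μ)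
    (h : ∀ x, |v x| ≤ |v₁ x| + |v₂ x|) :
    ∫ x, |v x| ^ (2 / 3 : ℝ) ∂μ ≤
      ∫ x, |v₁ x| ^ (2 / 3 : ℝ) ∂μ + ∫ x, |v₂ x| ^ (2 / 3 : ℝ) ∂μ := by
  have i1 := integrable_abs_rpow_two_thirds h1
  have i2 := integrable_abs_rpow_two_thirds h2
  rw [← integral_add i1 i2]
  refine integral_mono_of_nonneg (ae_of_all _ fun x => by positivity) (i1.add i2)
    (ae_of_all _ fun x => ?_)
  exact (Real.rpow_le_rpow (abs_nonneg _) (h x) (by norm_num)).trans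
    (Real.rpow_add_le_add_rpow (abs_nonneg _) (abs_nonneg _) (by norm_num) (by norm_num))

namespace Mesh

variable {N : ℕ} {π : Mesh N} {i : ℕ} {r v : ℝ → ℝ} {ε : ℝ}

theorem len_mul_avg_rpow_le_add {V : ℝ} (hi : i < N) (hv : MemLp v 2 muOmega) (hV : 0 ≤ V)
    (h : ∀ᵐ x ∂π.cellMeasure i, ∀ᵐ y ∂π.cellMeasure i, |v x - v y| ≤ V) :
    π.len i * π.avg v i ^ (2 / 3 : ℝ)
      ≤ (∫ x in π.cell i, |v x| ^ (2 / 3 : ℝ)) + π.len i * V ^ (2 / 3 : ℝ) := by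
  have := isProbabilityMeasure_cellMeasure (π := π) hi
  have hint := integrable_abs_rpow_two_thirds (memLp_cellMeasure hi hv (π := π))
  rw [← len_mul_integral_cellMeasure hi, ← mul_add]
  refine mul_le_mul_of_nonneg_left ?_ (π.len_pos hi).le
  calc π.avg v i ^ (2 / 3 : ℝ) = ∫ _, π.avg v i ^ (2 / 3 : ℝ) ∂π.cellMeasure i := by
        rw [integral_const, probReal_univ, one_smul]
    _ ≤ ∫ x, (|v x| ^ (2 / 3 : ℝ) + V ^ (2 / 3 : ℝ)) ∂π.cellMeasure i := by
        refine integral_mono_ae (integrable_const _) (hint.add (integrable_const _))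
          (h.mono fun x hx => ?_)
        have havg : π.avg v i ≤ |v x| + V := by
          refine avg_le_of_ae_abs_le hi (by positivity) (hx.mono fun y hy => ?_)
          linarith [abs_sub_abs_le_abs_sub (v y) (v x), abs_sub_comm (v x) (v y)]
        exact (Real.rpow_le_rpow (avg_nonneg v i) havg (by norm_num)).trans
          (Real.rpow_add_le_add_rpow (abs_nonneg _) hV (by norm_num) (by norm_num))
    _ = ∫ x, |v x| ^ (2 / 3 : ℝ) ∂π.cellMeasure i + V ^ (2 / 3 : ℝ) := by
        rw [integral_add hint (integrable_const _), integral_const, probReal_univ, one_smul]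

theorem avgSum_le_add_sum_oscillation {V : ℕ → ℝ} (hv : MemLp v 2 muOmega)
    (hV : ∀ i < N, 0 ≤ V i)
    (h : ∀ i < N, ∀ᵐ x ∂π.cellMeasure i, ∀ᵐ y ∂π.cellMeasure i, |v x - v y| ≤ V i) :
    π.avgSum v ≤ (∫ x in Omega, |v x| ^ (2 / 3 : ℝ))
      + ∑ i ∈ Finset.range N, π.len i * V i ^ (2 / 3 : ℝ) := by
  rw [← π.sum_integral_cell (integrable_abs_rpow_two_thirds hv), ← Finset.sum_add_distrib]
  refine Finset.sum_le_sum fun i hi => ?_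
  rw [Finset.mem_range] at hi
  exact len_mul_avg_rpow_le_add hi hv (hV i hi) (h i hi)

theorem sum_len_mul_rpow_le {V : ℕ → ℝ} (hV : ∀ i < N, 0 ≤ V i) (hε : ∀ i < N, π.len i ≤ ε) :
    ∑ i ∈ Finset.range N, π.len i * V i ^ (2 / 3 : ℝ)
      ≤ (ε * ∑ i ∈ Finset.range N, V i) ^ (2 / 3 : ℝ) := by
  simp only [← Finset.mem_range] at hV hε
  have hlen : ∀ i ∈ Finset.range N, 0 ≤ π.len i := fun i hi =>
    (π.len_pos (Finset.mem_range.1 hi)).le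
  have hconcave := Real.concaveOn_rpow (p := 2 / 3) (by norm_num) (by norm_num)
  refine (hconcave.le_map_sum hlen π.sum_len hV).trans (Real.rpow_le_rpow
    (Finset.sum_nonneg fun i hi => mul_nonneg (hlen i hi) (hV i hi)) ?_ (by norm_num))
  rw [Finset.mul_sum]
  exact Finset.sum_le_sum fun i hi => mul_le_mul_of_nonneg_right (hε i hi) (hV i hi)

theorem avgSum_le_of_memW1 (hr : MemLp r 2 muOmega) (hr' : MemW1 1 r)
    (hε : ∀ i < N, π.len i ≤ ε) :
    π.avgSum r ≤ (∫ x in Omega, |r x| ^ (2 / 3 : ℝ))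
      + (ε * ∫ x in Omega, |weakDeriv r x|) ^ (2 / 3 : ℝ) := by
  have hd : Integrable (weakDeriv r) muOmega := memLp_one_iff_integrable.1 hr'.memLp_weakDeriv
  obtain ⟨k, hk⟩ := hr'.hasWeakDeriv.exists_ae_eq_prim hd
  have hV : ∀ i < N, 0 ≤ ∫ x in π.cell i, |weakDeriv r x| := fun _ _ =>
    integral_nonneg fun _ => abs_nonneg _
  have hsum := sum_len_mul_rpow_le hV hε
  rw [π.sum_integral_cell hd.abs] at hsum
  exact (avgSum_le_add_sum_oscillation hr hV fun i hi =>
    ae_ae_abs_sub_le hd hi (ae_cellMeasure hi hk)).trans (by gcongr)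

theorem avgSum_le_add_avgSum_sub (hr : MemLp r 2 muOmega) (hv : MemLp v 2 muOmega) :
    π.avgSum r ≤ π.avgSum v + π.avgSum (fun x => r x - v x) :=
  avgSum_le_add hr hv (hr.sub hv) (ae_of_all _ fun x => by
    simpa only [add_sub_cancel] using abs_add_le (v x) (r x - v x))

theorem avgSum_sub_integral_rpow_le (hr : MemLp r 2 muOmega) (hv : MemLp v 2 muOmega) :
    π.avgSum r - ∫ x in Omega, |r x| ^ (2 / 3 : ℝ)
      ≤ π.avgSum v - (∫ x in Omega, |v x| ^ (2 / 3 : ℝ))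
        + 2 * (∫ x in Omega, (r x - v x) ^ 2) ^ (1 / 3 : ℝ) := by
  have hd : MemLp (fun x => r x - v x) 2 muOmega := hr.sub hv
  have hint : ∫ x in Omega, |v x| ^ (2 / 3 : ℝ)
      ≤ (∫ x in Omega, |r x| ^ (2 / 3 : ℝ)) + ∫ x in Omega, |r x - v x| ^ (2 / 3 : ℝ) :=
    integral_abs_rpow_two_thirds_le_add hr hd fun x => by
      simpa only [sub_sub_cancel] using abs_sub (r x) (r x - v x)
  linarith [avgSum_le_add_avgSum_sub (π := π) hr hv, integral_rpow_le_avgSum (π := π) hd,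
    avgSum_le_integral_sq (π := π) hd]

end Mesh

theorem exists_avgSum_le_of_uniformContinuous {v : ℝ → ℝ} {η : ℝ} (hv : MemLp v 2 muOmega)
    (huc : UniformContinuous v) (hη : 0 < η) :
    ∃ δ > 0, ∀ (N : ℕ) (π : Mesh N), (∀ i < N, π.len i ≤ δ) →
      π.avgSum v ≤ (∫ x in Omega, |v x| ^ (2 / 3 : ℝ)) + η := by
  have hV : 0 < η ^ (3 / 2 : ℝ) := by positivity
  obtain ⟨δ, hδ, hosc⟩ := Metric.uniformContinuous_iff.1 huc _ hV
  refine ⟨δ, hδ, fun N π hπ => ?_⟩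
  refine (Mesh.avgSum_le_add_sum_oscillation hv (V := fun _ => η ^ (3 / 2 : ℝ))
    (fun _ _ => hV.le) fun i hi => ?_).trans_eq ?_
  · filter_upwards [Mesh.ae_mem_cell i] with x hx
    filter_upwards [Mesh.ae_mem_cell i] with y hy
    refine (hosc (lt_of_lt_of_le ?_ (hπ i hi))).le
    rw [Real.dist_eq, Mesh.len, abs_sub_lt_iff]
    constructor <;> linarith [hx.1, hx.2, hy.1, hy.2]
  · rw [← Finset.sum_mul, π.sum_len, one_mul, ← Real.rpow_mul hη.le]
    norm_num

theorem exists_avgSum_le {r : ℝ → ℝ} {η : ℝ} (hr : MemLp r 2 muOmega) (hη : 0 < η) :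
    ∃ δ > 0, ∀ (N : ℕ) (π : Mesh N), (∀ i < N, π.len i ≤ δ) →
      π.avgSum r ≤ (∫ x in Omega, |r x| ^ (2 / 3 : ℝ)) + η := by
  have hr' : MemLp r (ENNReal.ofReal 2) muOmega := by simpa using hr
  obtain ⟨v, hvc, hvr, hvcont, hv⟩ := hr'.exists_hasCompactSupport_integral_rpow_sub_le
    two_pos (ε := (η / 4) ^ 3) (by positivity)
  replace hv : MemLp v 2 muOmega := by simpa using hv
  simp only [Real.rpow_two, Real.norm_eq_abs, sq_abs] at hvr
  obtain ⟨δ, hδ, h⟩ := exists_avgSum_le_of_uniformContinuous hv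
    (hvc.uniformContinuous_of_continuous hvcont) (half_pos hη)
  refine ⟨δ, hδ, fun N π hπ => ?_⟩
  have hclose : (∫ x in Omega, (r x - v x) ^ 2) ^ (1 / 3 : ℝ) ≤ η / 4 := by
    rw [one_div, Real.rpow_inv_le_iff_of_pos (integral_nonneg fun _ => sq_nonneg _)
      (by positivity) three_pos]
    exact_mod_cast hvr
  linarith [h N π hπ, Mesh.avgSum_sub_integral_rpow_le (π := π) hr hv]

theorem tendsto_avgSum {r : ℝ → ℝ} {N : ℕ → ℕ} {π : ∀ k, Mesh (N k)} {ε : ℕ → ℝ}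
    (hr : MemLp r 2 muOmega) (hlen : ∀ k, ∀ i < N k, (π k).len i ≤ ε k)
    (hε : Tendsto ε atTop (𝓝 0)) :
    Tendsto (fun k => (π k).avgSum r) atTop (𝓝 (∫ x in Omega, |r x| ^ (2 / 3 : ℝ))) := by
  refine tendsto_order.2 ⟨fun b hb => Eventually.of_forall fun k =>
    hb.trans_le (Mesh.integral_rpow_le_avgSum hr), fun b hb => ?_⟩
  obtain ⟨δ, hδ, h⟩ := exists_avgSum_le hr (half_pos (sub_pos.2 hb))
  filter_upwards [hε.eventually (gt_mem_nhds hδ)] with k hk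
  linarith [h (N k) (π k) fun i hi => (hlen k i hi).trans hk.le]

namespace Mesh

variable {N : ℕ} {π : Mesh N} {r v w R : ℝ → ℝ} {C δ κ : ℝ}

theorem avgSum_le_one_add_mul (hr : MemLp r 2 muOmega) (hv : MemLp v 2 muOmega)
    (h : π.avgSum (fun x => r x - v x) ≤ δ * π.avgSum v) :
    π.avgSum r ≤ (1 + δ) * π.avgSum v := by
  linarith [avgSum_le_add_avgSum_sub (π := π) hr hv]

theorem one_sub_mul_avgSum_le (hr : MemLp r 2 muOmega) (hv : MemLp v 2 muOmega)
    (h : π.avgSum (fun x => r x - v x) ≤ δ * π.avgSum v) :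
    (1 - δ) * π.avgSum v ≤ π.avgSum r := by
  have hsum : π.avgSum v ≤ π.avgSum r + π.avgSum fun x => r x - v x :=
    avgSum_le_add hv hr (hr.sub hv) (ae_of_all _ fun x => by
      simpa only [sub_sub_cancel] using abs_sub (r x) (r x - v x))
  linarith

theorem rpow_neg_mul_normLp_le_sqrt_alpha (hr : MemLp r 2 muOmega) (hv : MemLp v 2 muOmega)
    (hδ : 0 ≤ δ) (h : π.avgSum (fun x => r x - v x) ≤ δ * π.avgSum v) :
    (1 + δ) ^ (-(3 / 2) : ℝ) * normLp (2 / 3) r ≤ √(π.alpha v) := by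
  rw [normLp_two_thirds hr, sqrt_alpha,
    rpow_neg_mul_rpow (by positivity) (integral_nonneg fun _ => by positivity)]
  refine Real.rpow_le_rpow ?_ ?_ (by norm_num)
  · exact mul_nonneg (by positivity) (integral_nonneg fun _ => by positivity)
  rw [inv_mul_le_iff₀ (by positivity)]
  exact (integral_rpow_le_avgSum hr).trans (avgSum_le_one_add_mul hr hv h)

theorem sqrt_alpha_le_rpow_neg_mul {ε : ℝ} (hr : MemLp r 2 muOmega) (hr' : MemW1 1 r)
    (hv : MemLp v 2 muOmega) (hδ : δ < 1)
    (h : π.avgSum (fun x => r x - v x) ≤ δ * π.avgSum v) (hε : ∀ i < N, π.len i ≤ ε) :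
    √(π.alpha v) ≤ (1 - δ) ^ (-(3 / 2) : ℝ) *
      (normLp (2 / 3) r ^ (2 / 3 : ℝ) + (ε * normLp 1 (weakDeriv r)) ^ (2 / 3 : ℝ))
        ^ (3 / 2 : ℝ) := by
  have hle := (one_sub_mul_avgSum_le hr hv h).trans (avgSum_le_of_memW1 hr hr' hε)
  have hS := avgSum_nonneg (π := π) v
  have hδ' := sub_pos.2 hδ
  rw [← normLp_two_thirds_rpow hr, ← normLp_one hr'.memLp_weakDeriv] at hle
  rw [sqrt_alpha, rpow_neg_mul_rpow hδ'.le ((mul_nonneg hδ'.le hS).trans hle)]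
  exact Real.rpow_le_rpow hS ((le_inv_mul_iff₀ hδ').2 hle) (by norm_num)

theorem IsQuasiEquidistributing.normLp_two_le (h : π.IsQuasiEquidistributing v κ) (hC : 0 ≤ C)
    (hv : MemLp v 2 muOmega) (hR : MemLp R 2 muOmega) (hw : MemLp w 2 muOmega)
    (hRv : ∀ i < N, ∀ᵐ x ∂π.cellMeasure i, |R x| ≤ ∫ t in π.cell i, |v t|)
    (hwR : ∫ x in Omega, w x ^ 2 ≤ C ^ 2 * ∫ x in Omega, R x ^ 2) :
    normLp 2 w ≤ 2 * C * √(π.alpha v * κ ^ 3) / N := by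
  have hκ := h.one_le
  have hα := alpha_nonneg (π := π) v
  rw [normLp_two hw]
  refine Real.sqrt_le_iff.2 ⟨by positivity, hwR.trans ?_⟩
  calc C ^ 2 * ∫ x in Omega, R x ^ 2 ≤ C ^ 2 * ((2 * κ / N) ^ 2 * π.alpha v) := by
        gcongr
        exact h.integral_sq_le hv hR hRv
    _ = (2 * C) ^ 2 * (π.alpha v * κ ^ 2) / N ^ 2 := by ring
    _ ≤ (2 * C) ^ 2 * (π.alpha v * κ ^ 3) / N ^ 2 := by
        gcongr
        norm_num
    _ = (2 * C * √(π.alpha v * κ ^ 3) / N) ^ 2 := by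
        rw [div_pow, mul_pow _ (√_), Real.sq_sqrt (by positivity)]

end Mesh

theorem tendsto_sqrt_alpha {r : ℝ → ℝ} {N : ℕ → ℕ} {π : ∀ k, Mesh (N k)} {v : ℕ → ℝ → ℝ}
    {δ ε : ℕ → ℝ} (hr : MemLp r 2 muOmega) (hv : ∀ k, MemLp (v k) 2 muOmega)
    (h : ∀ k, (π k).avgSum (fun x => r x - v k x) ≤ δ k * (π k).avgSum (v k))
    (hδ₀ : ∀ k, 0 ≤ δ k) (hδ : Tendsto δ atTop (𝓝 0))
    (hlen : ∀ k, ∀ i < N k, (π k).len i ≤ ε k) (hε : Tendsto ε atTop (𝓝 0)) :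
    Tendsto (fun k => √((π k).alpha (v k))) atTop (𝓝 (normLp (2 / 3) r)) := by
  have hr_lim := tendsto_avgSum hr hlen hε
  have hlow := hr_lim.div (hδ.const_add 1) (by norm_num)
  have hupp := hr_lim.div (hδ.const_sub 1) (by norm_num)
  rw [add_zero, div_one] at hlow
  rw [sub_zero, div_one] at hupp
  have hv_lim : Tendsto (fun k => (π k).avgSum (v k)) atTop
      (𝓝 (∫ x in Omega, |r x| ^ (2 / 3 : ℝ))) := by
    refine tendsto_of_tendsto_of_tendsto_of_le_of_le' hlow hupp (.of_forall fun k => ?_) ?_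
    · exact (div_le_iff₀' (by linarith [hδ₀ k])).2 (Mesh.avgSum_le_one_add_mul hr (hv k) (h k))
    · filter_upwards [hδ.eventually (gt_mem_nhds one_pos)] with k hk
      exact (le_div_iff₀' (sub_pos.2 hk)).2 (Mesh.one_sub_mul_avgSum_le hr (hv k) (h k))
  simp only [Mesh.sqrt_alpha, normLp_two_thirds hr]
  exact hv_lim.rpow_const (Or.inr (by norm_num))

theorem IsWeakSolution.memLp_pdeResidual {a₀ : ℝ} {a b c f u : ℝ → ℝ}
    (h : IsWeakSolution a b c f u) (hc : Coefficients a₀ a b c) (hf : MemLp f 2 muOmega) :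
    MemLp (pdeResidual a b c f u) 2 muOmega :=
  h.1.hasH10Deriv.memLp_pdeResidual hc hf

theorem Mesh.IsFESolution.memLp_pdeResidual {N : ℕ} {π : Mesh N} {a₀ : ℝ} {a b c f uh : ℝ → ℝ}
    (h : π.IsFESolution a b c f uh) (hc : Coefficients a₀ a b c) (hf : MemLp f 2 muOmega) :
    MemLp (pdeResidual a b c f uh) 2 muOmega := by
  obtain ⟨s, hs⟩ := exists_isSlope h.1
  exact hs.hasH10Deriv.memLp_pdeResidual hc hf

theorem Mesh.IsFESolution.memLp_weakDeriv_sub {N : ℕ} {π : Mesh N} {a b c f u uh : ℝ → ℝ}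
    (h : π.IsFESolution a b c f uh) (hu : MemH10 u) : MemLp (weakDeriv (u - uh)) 2 muOmega := by
  obtain ⟨s, hs⟩ := exists_isSlope h.1
  have hd := hu.hasH10Deriv.sub hs.hasH10Deriv
  exact (memLp_congr_ae hd.weakDeriv_ae_eq).2 hd.memLp

theorem Coefficients.exists_quasiEquidistribution_estimate {a₀ : ℝ} {a b c : ℝ → ℝ}
    (hc : Coefficients a₀ a b c) : ∃ C c₁ : ℝ, 0 < C ∧ 0 < c₁ ∧ ∀ f u : ℝ → ℝ,
      MemLp f 2 muOmega → IsWeakSolution a b c f u → ∀ (κ : ℝ) (N : ℕ) (π : Mesh N) (uh : ℝ → ℝ),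
      π.IsFESolution a b c f uh → π.IsQuasiEquidistributing (pdeResidual a b c f uh) κ →
      normLp 2 (weakDeriv (u - uh)) ≤ C * √(π.alpha (pdeResidual a b c f uh) * κ ^ 3) / N ∧
      π.avgSum (fun x => pdeResidual a b c f u x - pdeResidual a b c f uh x)
        ≤ (κ * c₁ / N) ^ (2 / 3 : ℝ) * π.avgSum (pdeResidual a b c f uh) ∧
      ∀ i < N, π.len i ≤ κ * c₁ / N := by
  obtain ⟨C, hC1, hC⟩ := hc.exists_error_estimate
  have hC0 := zero_le_one.trans hC1
  refine ⟨2 * C, 6 * C, by positivity, by positivity, fun f u hf hu κ N π uh hFE hQ => ?_⟩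
  obtain ⟨R, hR, hRuh, herror, hres⟩ := hC f u hf hu N π uh hFE
  have hrh := hFE.memLp_pdeResidual hc hf
  have hκ := hQ.one_le
  exact ⟨hQ.normLp_two_le hC0 hrh hR (hFE.memLp_weakDeriv_sub hu.1) hRuh herror,
    hQ.avgSum_sub_le hC0 (hu.memLp_pdeResidual hc hf) hrh hR hRuh hres,
    fun i hi => (hQ.len_le hi).trans (by gcongr ?_ / _; nlinarith)⟩

end AdaptiveFEM

theorem theorem2p2 (a₀ : ℝ) (a b c : ℝ → ℝ) (hcoef : Coefficients a₀ a b c) :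
    ∃ C c₁ : ℝ, 0 < C ∧ 0 < c₁ ∧
      ∀ f u : ℝ → ℝ, MemLp f 2 muOmega → IsWeakSolution a b c f u → ∀ κ : ℝ, 0 < κ →
        -- the error bound
        (∀ (N : ℕ) (π : Mesh N) (uh : ℝ → ℝ), π.IsFESolution a b c f uh →
          π.IsQuasiEquidistributing (pdeResidual a b c f uh) κ →
          normLp 2 (weakDeriv (u - uh)) ≤
            C * √(π.alpha (pdeResidual a b c f uh) * κ ^ 3) / N) ∧
        -- the limit of the intensity parameter, along any such meshes with `N → ∞`
        (∀ (N : ℕ → ℕ) (π : ∀ k, Mesh (N k)) (uh : ℕ → ℝ → ℝ),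
          (∀ k, (π k).IsFESolution a b c f (uh k)) →
          (∀ k, (π k).IsQuasiEquidistributing (pdeResidual a b c f (uh k)) κ) →
          Tendsto N atTop atTop →
          Tendsto (fun k => √((π k).alpha (pdeResidual a b c f (uh k)))) atTop
            (𝓝 (normLp (2 / 3) (pdeResidual a b c f u)))) ∧
        -- the two-sided bound when `r' ∈ L¹`
        (MemW1 1 (pdeResidual a b c f u) →
          ∀ (N : ℕ) (π : Mesh N) (uh : ℝ → ℝ), π.IsFESolution a b c f uh →
          π.IsQuasiEquidistributing (pdeResidual a b c f uh) κ → κ * c₁ < N →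
          (1 + (κ * c₁ / N) ^ (2 / 3 : ℝ)) ^ (-(3 / 2) : ℝ)
              * normLp (2 / 3) (pdeResidual a b c f u)
            ≤ √(π.alpha (pdeResidual a b c f uh)) ∧
          √(π.alpha (pdeResidual a b c f uh))
            ≤ (1 - (κ * c₁ / N) ^ (2 / 3 : ℝ)) ^ (-(3 / 2) : ℝ)
              * (normLp (2 / 3) (pdeResidual a b c f u) ^ (2 / 3 : ℝ)
                + (κ * c₁ * normLp 1 (weakDeriv (pdeResidual a b c f u)) / N) ^ (2 / 3 : ℝ))
                  ^ (3 / 2 : ℝ)) := by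
  obtain ⟨C, c₁, hC, hc₁, hest⟩ := hcoef.exists_quasiEquidistribution_estimate
  refine ⟨C, c₁, hC, hc₁, fun f u hf hu κ hκ => ?_⟩
  have hr := hu.memLp_pdeResidual hcoef hf
  refine ⟨fun N π uh hFE hQ => (hest f u hf hu κ N π uh hFE hQ).1,
    fun N π uh hFE hQ hN => ?limit, fun hr' N π uh hFE hQ hκN => ?bounds⟩
  case limit =>
    have hε := (tendsto_natCast_atTop_atTop.comp hN).const_div_atTop (κ * c₁)
    have hδ := hε.rpow_const (p := 2 / 3) (.inr (by norm_num))
    rw [Real.zero_rpow (by norm_num)] at hδ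
    have hest := fun k => hest f u hf hu κ (N k) (π k) (uh k) (hFE k) (hQ k)
    exact tendsto_sqrt_alpha hr (fun k => (hFE k).memLp_pdeResidual hcoef hf)
      (fun k => (hest k).2.1) (fun k => by positivity) hδ (fun k => (hest k).2.2) hε
  case bounds =>
    have hN : (0 : ℝ) < N := (mul_pos hκ hc₁).trans hκN
    have hδ : (κ * c₁ / N) ^ (2 / 3 : ℝ) < 1 :=
      Real.rpow_lt_one (by positivity) ((div_lt_one hN).2 hκN) (by norm_num)
    obtain ⟨-, hsub, hlen⟩ := hest f u hf hu κ N π uh hFE hQ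
    have hrh := hFE.memLp_pdeResidual hcoef hf
    rw [mul_div_right_comm (κ * c₁)]
    exact ⟨Mesh.rpow_neg_mul_normLp_le_sqrt_alpha hr hrh (by positivity) hsub,
      Mesh.sqrt_alpha_le_rpow_neg_mul hr hr' hrh hδ hsub hlen⟩
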